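/- Let $t$ be a prime, let $q\ge t$ be a prime power, and let $1\le\nu\le t-1$, $\sigma\colon x\mapsto x^{q^\nu}$ on $\mathbb F_{q^t}$; $N$ denotes the norm of $\mathbb F_{q^t}$ over $\mathbb F_q$. Let $\Sigma\cong\mathrm{PG}(t-1,q)$ be a $q$-order canonical subgeometry of $\mathrm{PG}(t-1,q^t)$, and let $\hat\sigma$ be the collineation of $\mathrm{PG}(t-1,q^t)$ with companion automorphism $\sigma$ that fixes $\Sigma$ pointwise. Let $P_\Gamma$ be a point with $\langle P_\Gamma,P_\Gamma^{\hat\sigma},\dots,P_\Gamma^{\hat\sigma^{t-1}}\rangle=\mathrm{PG}(t-1,q^t)$, let $\Gamma=\langle P_\Gamma,P_\Gamma^{\hat\sigma},\dots,P_\Gamma^{\hat\sigma^{t-3}}\rangle$ (so $\Gamma=\emptyset$ if $t=2$), let $\ell_0$ be a line disjoint from $\Gamma$, and let $p\colon X\mapsto\langle\Gamma,X\rangle\cap\ell_0$ be the projection from $\Gamma$ onto $\ell_0$. Take homogeneous coordinates on $\ell_0$ in which the points $\langle\Gamma,P_\Gamma^{\hat\sigma^{t-2}}\rangle\cap\ell_0$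 and $\langle\Gamma,P_\Gamma^{\hat\sigma^{t-1}}\rangle\cap\ell_0$ are $\langle(1,0)\rangle$ and $\langle(0,1)\rangle$, and in which the projection of $\Sigma$ is the linear set of pseudoregulus type $\mathbb L=p(\Sigma)=\{\langle(\mu,\mu^\sigma)\rangle_{\mathbb F_{q^t}}:\mu\in\mathbb F_{q^t}^*\}$. For $h\in\{0,\dots,t-1\}$ let $\mathcal S_h$ be the family of the subspaces $S_{h,k}=\{\langle(z,kz^{q^h})\rangle_{\mathbb F_q}:z\in\mathbb F_{q^t}^*\}$ of $\mathrm{PG}(2t-1,q)=\mathrm{PG}_q(\mathbb F_{q^t}^2)$, where $k\in\mathbb F_{q^t}$ and $N(k)=1$; indices $h$ are read modulo $t$. For a line $f$ of $\mathrm{PG}(2t-1,q)$ let $\mathcal B(f)$ be the set of all points $\langle(a,b)\rangle_{\mathbb F_{q^t}}$ of $\ell_0$ with $\langle(a,b)\rangle_{\mathbb F_q}\in f$, and let $C_f=\Sigma\cap p^{-1}(\mathcal B(f))$. A normal rational curve of order $n$ over a field $A$ is the set $\{\langle e_0+ye_1+\dots+y^ne_n\rangle:y\in A\}\cup\{\langle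 e_n\rangle\}$, where $e_0,\dots,e_n$ are linearly independent vectors; a curve in $\Sigma$ is taken over $A=\mathbb F_q$ with $e_0,\dots,e_n$ in the $\mathbb F_q$-space defining $\Sigma$, and a curve in $\mathrm{PG}(t-1,q^t)$ is taken over $A=\mathbb F_{q^t}$ and is called $\Sigma$-rational if the $e_j$ can be chosen in the $\mathbb F_q$-space defining $\Sigma$. (1) For every $h\in\{1,\dots,t-1\}$ and every line $f$ contained in an element of $\mathcal S_h$, the set $\mathcal B(f)$ is a $q$-order subline, $C_f$ is a normal rational curve in an $n$-dimensional subspace of $\Sigma$ of order $n$, where $1\le n\le t-1$ and $n\equiv h\nu^{-1}\pmod t$, and $p(C_f)=\mathcal B(f)$. (2) Suppose $q>t$. For every line $f$ contained in an element of $\mathcal S_{-\nu}$ there is exactly one $\Sigma$-rational normal rational curve $\mathcal C$ of order $t-1$ in $\mathrm{PG}(t-1,q^t)$ with $\mathcal C\cap\Sigma=C_f$. The curves $\mathcal C$ arising in this way from the lines contained in elements of $\mathcal S_{-\nu}$ are exactly the normal rational curves of order $t-1$ in $\mathrm{PG}(t-1,q^t)$ that contain all the points $P_\Gamma^{\hat\sigma^i}$,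 $i=0,1,\dots,t-1$, and at least two points of $\Sigma$. -/

import Mathlib

namespace PseudoReg

/-- The points `⟨s⟩` of `PG(V)` (over `K`) with `s` a nonzero vector of the `F`-subspace `S` of `V`. -/
def pointsOf {F : Type*} (K : Type*) {V : Type*} [Field F] [Field K] [AddCommGroup V]
    [Module F V] [Module K V] (S : Submodule F V) : Set (Projectivization K V) :=
  {X | ∃ s ∈ S, s ≠ 0 ∧ X.submodule = Submodule.span K {s}}

/-- `W` defines a canonical subgeometry `pointsOf K W` of `PG(V)`: it is an `F`-subspace whose
dimension over `F` equals that of `V` over `K`, and it spans `V` over `K`. -/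
def IsCanonical {F : Type*} (K : Type*) {V : Type*} [Field F] [Field K] [AddCommGroup V]
    [Module F V] [Module K V] (W : Submodule F V) : Prop :=
  Module.finrank F W = Module.finrank K V ∧ Submodule.span K (W : Set V) = ⊤

/-- A subline of order `|F|`: a canonical subgeometry of a line of `PG(V)`. -/
def IsSubline (F : Type*) {K V : Type*} [Field F] [Field K] [AddCommGroup V]
    [Module F V] [Module K V] (r : Set (Projectivization K V)) : Prop :=
  ∃ U : Submodule F V, Module.finrank F U = 2 ∧
    Module.finrank K (Submodule.span K (U : Set V)) = 2 ∧ r = pointsOf K U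

/-- The image of a set of points under the projection `X ↦ ⟨Γ, X⟩ ∩ ℓ₀`. -/
def project {K V : Type*} [Field K] [AddCommGroup V] [Module K V] (Γ ℓ₀ : Submodule K V)
    (C : Set (Projectivization K V)) : Set (Projectivization K V) :=
  {Y | ∃ X ∈ C, Y.submodule = (Γ ⊔ X.submodule) ⊓ ℓ₀}

/-- The preimage of a set of points under the projection `X ↦ ⟨Γ, X⟩ ∩ ℓ₀`. -/
def projectPreimage {K V : Type*} [Field K] [AddCommGroup V] [Module K V] (Γ ℓ₀ : Submodule K V)
    (r : Set (Projectivization K V)) : Set (Projectivization K V) :=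
  {X | ∃ Y ∈ r, Y.submodule = (Γ ⊔ X.submodule) ⊓ ℓ₀}

/-- The points `⟨e₀ + y e₁ + ⋯ + yⁿ eₙ⟩`, with `y` in the field `A`, together with `⟨eₙ⟩`. -/
def curvePoints (A : Type*) {K V : Type*} [Field A] [Field K] [Algebra A K] [AddCommGroup V]
    [Module K V] {n : ℕ} (e : Fin (n + 1) → V) : Set (Projectivization K V) :=
  {X | (∃ y : A, X.submodule =
      Submodule.span K {∑ j : Fin (n + 1), (algebraMap A K y) ^ (j : ℕ) • e j}) ∨
    X.submodule = Submodule.span K {e (Fin.last n)}}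

/-- A normal rational curve of order `n` in some `n`-subspace of `PG(V)` over `K`. -/
def IsNRC {K V : Type*} [Field K] [AddCommGroup V] [Module K V] (n : ℕ)
    (C : Set (Projectivization K V)) : Prop :=
  ∃ e : Fin (n + 1) → V, LinearIndependent K e ∧ C = curvePoints K e

/-- A normal rational curve of `PG(V)` over `K` that is rational with respect to the canonical
subgeometry of `W`, i.e. it is in standard form with respect to vectors of `W`. -/
def IsRationalNRC {F K V : Type*} [Field F] [Field K] [AddCommGroup V]
    [Module F V] [Module K V] (W : Submodule F V) (n : ℕ)
    (C : Set (Projectivization K V)) : Prop :=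
  ∃ e : Fin (n + 1) → V, LinearIndependent K e ∧ (∀ j, e j ∈ W) ∧ C = curvePoints K e

/-- A normal rational curve of order `n` (over `F`) in some `n`-subspace of the canonical subgeometry
of `W`, which is a projective space over `F`. -/
def IsNRCInside {F K V : Type*} [Field F] [Field K] [Algebra F K] [AddCommGroup V]
    [Module F V] [Module K V] (W : Submodule F V) (n : ℕ)
    (C : Set (Projectivization K V)) : Prop :=
  ∃ e : Fin (n + 1) → V, LinearIndependent K e ∧ (∀ j, e j ∈ W) ∧ C = curvePoints F e

/-- The `F`-subspace `{(z, k z^(q^h)) : z ∈ K}` of `K²`, where `q = |F|`. -/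
def S (F : Type*) {K : Type*} [Field F] [Fintype F] [Field K] [Algebra F K] (h : ℕ) (k : K) :
    Submodule F (K × K) where
  carrier := {p | p.2 = k * p.1 ^ (Fintype.card F ^ h)}
  zero_mem' := by
    have : Fintype.card F ≠ 0 := Fintype.card_ne_zero
    simp [this]
  add_mem' := by
    intro a b ha hb
    have key : ∀ x : K, x ^ (Fintype.card F ^ h) = ((FiniteField.frobeniusAlgHom F K) ^ h) x := by
      intro x
      simp [AlgHom.coe_pow, FiniteField.coe_frobeniusAlgHom, pow_iterate]
    simp only [Set.mem_ofPred_eq, key] at ha hb ⊢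
    simp [ha, hb, mul_add]
  smul_mem' := by
    intro c a ha
    have key : ∀ x : K, x ^ (Fintype.card F ^ h) = ((FiniteField.frobeniusAlgHom F K) ^ h) x := by
      intro x
      simp [AlgHom.coe_pow, FiniteField.coe_frobeniusAlgHom, pow_iterate]
    simp only [Set.mem_ofPred_eq, key] at ha ⊢
    simp [ha]

/-- `f` is a line of `PG(K²)` over `F` contained in an element `S_{h,k}`, `N(k) = 1`,
of the family with index `h`. -/
def IsLineInFamily {F K : Type*} [Field F] [Fintype F] [Field K] [Algebra F K] (h : ℕ)
    (f : Submodule F (K × K)) : Prop :=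
  Module.finrank F f = 2 ∧ ∃ k : K, Algebra.norm F k = 1 ∧ f ≤ S F h k

/-- The linear set `B(f)` on the line with homogeneous coordinates `(a, b) ↦ ⟨a v₁ + b v₂⟩`. -/
def B {F K V : Type*} [Field F] [Field K] [Algebra F K] [AddCommGroup V] [Module K V]
    (v₁ v₂ : V) (f : Submodule F (K × K)) : Set (Projectivization K V) :=
  {Y | ∃ p ∈ f, p ≠ 0 ∧ Y.submodule = Submodule.span K {p.1 • v₁ + p.2 • v₂}}

/-- The set of points of the canonical subgeometry of `W` that are projected from `Γ` to `ℓ₀`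
into `B(f)`. -/
def curveOf {F K V : Type*} [Field F] [Field K] [Algebra F K] [AddCommGroup V]
    [Module F V] [Module K V] (W : Submodule F V) (Γ ℓ₀ : Submodule K V) (v₁ v₂ : V)
    (f : Submodule F (K × K)) : Set (Projectivization K V) :=
  pointsOf K W ∩ projectPreimage Γ ℓ₀ (B v₁ v₂ f)

end PseudoReg

namespace PseudoReg

open Submodule

/-! Write `τ` for `x ↦ x ^ (q ^ ν)`. As `t` is prime, `τ` and all its nontrivial powers generate the
Galois group of `K/F`. A vector fixed by `φ` has coordinates `x, τ x, τ² x, …` in the basis `φⁱ(P)`,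
so the subgeometry is a copy of `K`. After rescaling there is an `F`-isomorphism `u : K → W` such
that `⟨u μ⟩` is projected to `⟨μ v₁ + τ(μ) v₂⟩` (`exists_parametrization`).

Choose `n` with `nν ≡ h` modulo `t`. By Hilbert 90 the vectors of a line `f` are, up to one common
scalar, the pairs `(y, τⁿ y)` with `y = s a + r b` and `s, r ∈ F`. Hence `⟨u μ⟩` lies on `C_f`
exactly when `τ(μ)/μ = τⁿ(y)/y` for such a `y ≠ 0`. By telescoping, `μ` is then an `F`-multiple of
`y · τ(y) ⋯ τⁿ⁻¹(y)`. This product is a binary form of degree `n` in `(s, r)`, and its coefficients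
are linearly independent over `F` when `n < t` (`orbitPoly_coeff_relation`). So `C_f` is a normal
rational curve (`curveOf_eq_curvePoints`).

For `h = -ν` one has `n = t - 1`. Over `K`, each coordinate of the form in the basis of multiples of
`φⁱ(P)` is a product over all conjugates of `s a + r b` but one, where the conjugates act on `a, b`
only. At `(-τ b, τ a)` every coordinate vanishes except that of `P`. So the extended curve contains
`⟨P⟩` and, being rational over `F`, its whole orbit. Conversely, two points `⟨u μ₁⟩, ⟨u μ₂⟩`
determine the line with `a = τ(μ₁⁻¹)`, `b = τ(μ₂⁻¹)`, whose curve contains them and the orbit. These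
`t + 2` points lie on only one normal rational curve of order `t - 1`
(`curvePoints_subset_of_common_points`). The same fact gives uniqueness in (2), as `C_f` has `q + 1
≥ t + 2` points. -/

/-- The point with homogeneous parameters `(s, r)` on the rational curve defined by `e`. -/
def param {K V : Type*} [Field K] [AddCommGroup V] [Module K V] {n : ℕ}
    (e : Fin (n + 1) → V) (s r : K) : V :=
  ∑ j : Fin (n + 1), (s ^ (j.rev : ℕ) * r ^ (j : ℕ)) • e j

/-! ### Binary forms, Lagrange interpolation, and normal rational curves through given points. -/

section Param

variable {K V : Type*} [Field K] [AddCommGroup V] [Module K V] {n : ℕ}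

lemma span_singleton_eq_iff {x y : V} :
    span K {x} = span K {y} ↔ ∃ c : K, c ≠ 0 ∧ x = c • y := by
  rw [eq_comm, Submodule.span_singleton_eq_span_singleton]
  constructor
  · rintro ⟨z, rfl⟩
    exact ⟨z, z.ne_zero, rfl⟩
  · rintro ⟨c, hc, rfl⟩
    exact ⟨Units.mk0 c hc, rfl⟩

lemma param_one (e : Fin (n + 1) → V) (y : K) :
    param e 1 y = ∑ j : Fin (n + 1), y ^ (j : ℕ) • e j := by
  simp [param]

lemma param_one_zero (e : Fin (n + 1) → V) : param e (1 : K) 0 = e 0 := by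
  rw [param, Finset.sum_eq_single 0]
  · simp
  · intro j _ hj
    have : (j : ℕ) ≠ 0 := fun h => hj (Fin.ext h)
    simp [this]
  · simp

lemma param_zero_one (e : Fin (n + 1) → V) : param e (0 : K) 1 = e (Fin.last n) := by
  rw [param, Finset.sum_eq_single (Fin.last n)]
  · simp
  · intro j _ hj
    have : (j.rev : ℕ) ≠ 0 := by
      intro h
      apply hj
      ext
      rw [Fin.val_rev] at h
      simp only [Fin.val_last]
      omega
    simp only [zero_pow this, zero_mul, zero_smul]
  · simp

lemma param_mul (e : Fin (n + 1) → V) (c s r : K) :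
    param e (c * s) (c * r) = c ^ n • param e s r := by
  rw [param, param, Finset.smul_sum]
  refine Finset.sum_congr rfl fun j _ => ?_
  rw [smul_smul]
  congr 1
  have h : (j.rev : ℕ) + j = n := by
    rw [Fin.val_rev]; omega
  have h2 : c ^ n = c ^ (j.rev : ℕ) * c ^ (j : ℕ) := by rw [← pow_add, h]
  rw [h2, mul_pow, mul_pow]
  ring

lemma param_ne_zero {e : Fin (n + 1) → V} (he : LinearIndependent K e) {s r : K}
    (h : ¬ (s = 0 ∧ r = 0)) : param e s r ≠ 0 := by
  intro h0
  rw [Fintype.linearIndependent_iff] at he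
  have h1 := he _ h0
  apply h
  constructor
  · have := h1 0
    simp at this
    exact this.1
  · have := h1 (Fin.last n)
    simp at this
    exact this.1

lemma mem_curvePoints {A : Type*} [Field A] [Algebra A K] {e : Fin (n + 1) → V}
    {X : Projectivization K V} :
    X ∈ curvePoints A e ↔ ∃ s r : A, ¬ (s = 0 ∧ r = 0) ∧
      X.submodule = span K {param e (algebraMap A K s) (algebraMap A K r)} := by
  constructor
  · rintro (⟨y, hy⟩ | h)
    · refine ⟨1, y, by simp, ?_⟩
      rw [hy, map_one, param_one]
    · refine ⟨0, 1, by simp, ?_⟩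
      rw [h, map_zero, map_one, param_zero_one]
  · rintro ⟨s, r, hsr, h⟩
    by_cases hs : s = 0
    · right
      have hr : r ≠ 0 := fun hr => hsr ⟨hs, hr⟩
      rw [h, ← param_zero_one (K := K) e, span_singleton_eq_iff]
      refine ⟨(algebraMap A K r) ^ n, by simp [hr], ?_⟩
      rw [← param_mul, hs]; simp
    · left
      refine ⟨r / s, ?_⟩
      rw [h, ← param_one, span_singleton_eq_iff]
      have hs' : algebraMap A K s ≠ 0 := by simpa using hs
      refine ⟨(algebraMap A K s) ^ n, pow_ne_zero _ hs', ?_⟩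
      rw [← param_mul, map_div₀, mul_one, mul_div_cancel₀ _ hs']

/-- A product of `n` linear forms is a binary form of degree `n`. -/
lemma sum_coeff_prod_linear {ι : Type*} (T : Finset ι) (α β : ι → K) (s r : K) :
    ∑ k ∈ Finset.range (T.card + 1),
      s ^ (T.card - k) * r ^ k *
        (∏ i ∈ T, (Polynomial.C (α i) + Polynomial.C (β i) * Polynomial.X)).coeff k =
      ∏ i ∈ T, (s * α i + r * β i) := by
  classical
  induction T using Finset.induction_on with
  | empty => simp
  | insert i T hi ih =>
    rw [Finset.prod_insert hi, Finset.prod_insert hi, Finset.card_insert_of_notMem hi]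
    set G := ∏ i ∈ T, (Polynomial.C (α i) + Polynomial.C (β i) * Polynomial.X) with hG
    have hdeg : G.coeff (T.card + 1) = 0 := by
      apply Polynomial.coeff_eq_zero_of_natDegree_lt
      refine lt_of_le_of_lt (Polynomial.natDegree_prod_le _ _) ?_
      refine lt_of_le_of_lt (Finset.sum_le_card_nsmul T _ 1 fun j _ => ?_) (by simp)
      compute_degree
    have e1 : ∑ k ∈ Finset.range (T.card + 1 + 1), s ^ (T.card + 1 - k) * r ^ k * G.coeff k =
        s * ∏ i ∈ T, (s * α i + r * β i) := by
      rw [Finset.sum_range_succ, hdeg, mul_zero, add_zero, ← ih, Finset.mul_sum]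
      refine Finset.sum_congr rfl fun k hk => ?_
      rw [Finset.mem_range] at hk
      rw [show T.card + 1 - k = (T.card - k) + 1 by omega, pow_succ]
      ring
    have e2 : ∑ k ∈ Finset.range (T.card + 1 + 1), s ^ (T.card + 1 - k) * r ^ k *
        (Polynomial.X * G).coeff k = r * ∏ i ∈ T, (s * α i + r * β i) := by
      rw [Finset.sum_range_succ', Polynomial.coeff_X_mul_zero, mul_zero, add_zero, ← ih,
        Finset.mul_sum]
      refine Finset.sum_congr rfl fun k hk => ?_
      rw [Polynomial.coeff_X_mul, Nat.add_sub_add_right]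
      ring
    calc _ = α i * (s * ∏ i ∈ T, (s * α i + r * β i)) +
          β i * (r * ∏ i ∈ T, (s * α i + r * β i)) := by
          rw [← e1, ← e2, Finset.mul_sum, Finset.mul_sum, ← Finset.sum_add_distrib]
          refine Finset.sum_congr rfl fun k _ => ?_
          rw [add_mul, Polynomial.coeff_add, Polynomial.coeff_C_mul, mul_assoc (Polynomial.C _),
            Polynomial.coeff_C_mul]
          ring
      _ = _ := by ring

lemma param_coeff_prod_linear {ι : Type*} (T : Finset ι) (hT : T.card = n) (α β : ι → K)
    (s r : K) :
    param (fun k : Fin (n + 1) =>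
      (∏ i ∈ T, (Polynomial.C (α i) + Polynomial.C (β i) * Polynomial.X)).coeff k) s r =
      ∏ i ∈ T, (s * α i + r * β i) := by
  rw [← sum_coeff_prod_linear, hT, param, Finset.sum_range]
  refine Finset.sum_congr rfl fun k _ => ?_
  rw [smul_eq_mul, Fin.val_rev, Nat.add_sub_add_right]

lemma det_projVandermonde_ne_zero {s r : Fin (n + 1) → K}
    (hsr : ∀ i j, i ≠ j → s i * r j ≠ r i * s j) : (Matrix.projVandermonde r s).det ≠ 0 := by
  rw [Matrix.det_projVandermonde, Finset.prod_ne_zero_iff]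
  intro i _
  rw [Finset.prod_ne_zero_iff]
  intro j hj
  rw [Finset.mem_Ioi] at hj
  rw [sub_ne_zero]
  intro h1
  apply hsr i j hj.ne
  rw [mul_comm (s i), h1]

/-- A binary form of degree `n` with `n + 1` zeros vanishes. -/
lemma eq_zero_of_param_eq_zero {c : Fin (n + 1) → K} {s r : Fin (n + 1) → K}
    (hsr : ∀ i j, i ≠ j → s i * r j ≠ r i * s j) (h : ∀ i, param c (s i) (r i) = 0) : c = 0 := by
  apply Matrix.eq_zero_of_mulVec_eq_zero (det_projVandermonde_ne_zero hsr)
  ext i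
  rw [Pi.zero_apply, ← h i, param, Matrix.mulVec, dotProduct]
  refine Finset.sum_congr rfl fun j _ => ?_
  rw [Matrix.projVandermonde_apply, smul_eq_mul]
  ring

/-- Homogeneous Lagrange interpolation on a rational curve. -/
lemma param_eq_sum_lagrange (e : Fin (n + 1) → V) {s r : Fin (n + 1) → K}
    (hsr : ∀ i j, i ≠ j → s i * r j ≠ r i * s j) (x y : K) :
    param e x y = ∑ i, (∏ j ∈ Finset.univ.erase i, (x * r j - y * s j)) •
      ((∏ j ∈ Finset.univ.erase i, (s i * r j - r i * s j))⁻¹ • param e (s i) (r i)) := by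
  classical
  set D : Fin (n + 1) → K := fun i => ∏ j ∈ Finset.univ.erase i, (s i * r j - r i * s j) with hD
  have hD0 : ∀ i, D i ≠ 0 := fun i => by
    rw [hD, Finset.prod_ne_zero_iff]
    intro j hj
    rw [sub_ne_zero]
    exact hsr i j (Finset.ne_of_mem_erase hj).symm
  -- Numerators of the Lagrange basis: `g i` is the form of degree `n` that vanishes at all nodes
  -- except the `i`-th.
  let g : Fin (n + 1) → Fin (n + 1) → K := fun i k =>
    (∏ j ∈ Finset.univ.erase i,
      (Polynomial.C (r j) + Polynomial.C (-s j) * Polynomial.X)).coeff k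
  have hg : ∀ i x y, param (g i) x y = ∏ j ∈ Finset.univ.erase i, (x * r j - y * s j) := by
    intro i x y
    rw [param_coeff_prod_linear _ (by simp)]
    refine Finset.prod_congr rfl fun j _ => by ring
  have hsum : ∀ (a c : Fin (n + 1) → K) (h : Fin (n + 1) → Fin (n + 1) → K) (x y : K),
      param (a - ∑ i, c i • h i) x y = param a x y - ∑ i, c i * param (h i) x y := by
    intro a c h x y
    simp only [param, Pi.sub_apply, Finset.sum_apply, Pi.smul_apply, smul_eq_mul, mul_sub,
      Finset.sum_sub_distrib, Finset.mul_sum]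
    congr 1
    rw [Finset.sum_comm]
    refine Finset.sum_congr rfl fun i _ => Finset.sum_congr rfl fun j _ => by ring
  have hsingle : ∀ (k : Fin (n + 1)) (x y : K),
      param (Pi.single k (1 : K)) x y = x ^ (k.rev : ℕ) * y ^ (k : ℕ) := by
    intro k x y
    rw [param, Finset.sum_eq_single k]
    · simp
    · intro j _ hj
      simp [hj]
    · simp
  have key : ∀ k : Fin (n + 1), ∀ x y : K, x ^ (k.rev : ℕ) * y ^ (k : ℕ) =
      ∑ i, (param (g i) x y) * ((D i)⁻¹ * ((s i) ^ (k.rev : ℕ) * (r i) ^ (k : ℕ))) := by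
    intro k x y
    -- Each monomial equals its interpolant, because their difference is a form of degree `n`
    -- vanishing at `n + 1` parameters.
    have hzero : (Pi.single k 1 - ∑ i, ((D i)⁻¹ * ((s i) ^ (k.rev : ℕ) * (r i) ^ (k : ℕ))) • g i :
        Fin (n + 1) → K) = 0 := by
      refine eq_zero_of_param_eq_zero hsr fun m => ?_
      rw [hsum, hsingle, Finset.sum_eq_single m, hg]
      · change _ - (D m)⁻¹ * _ * D m = 0
        have := hD0 m
        field_simp
        ring
      · intro i _ him
        rw [hg, Finset.prod_eq_zero (Finset.mem_erase.2 ⟨him.symm, Finset.mem_univ m⟩), mul_zero]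
        ring
      · simp
    have h := hsum (Pi.single k 1)
      (fun i => (D i)⁻¹ * ((s i) ^ (k.rev : ℕ) * (r i) ^ (k : ℕ))) g x y
    rw [hzero, hsingle, param.eq_1 0] at h
    simp only [Pi.zero_apply, smul_zero, Finset.sum_const_zero] at h
    rw [← sub_eq_zero, h]
    congr 1
    exact Finset.sum_congr rfl fun i _ => mul_comm _ _
  calc param e x y = ∑ k : Fin (n + 1), (x ^ (k.rev : ℕ) * y ^ (k : ℕ)) • e k := rfl
    _ = ∑ k : Fin (n + 1), ∑ i, ((param (g i) x y) * ((D i)⁻¹ * ((s i) ^ (k.rev : ℕ) * (r i) ^ (k : ℕ)))) •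
        e k := by
      refine Finset.sum_congr rfl fun k _ => ?_
      rw [key k, Finset.sum_smul]
    _ = _ := by
      rw [Finset.sum_comm]
      refine Finset.sum_congr rfl fun i _ => ?_
      rw [← hg, param.eq_1 e, Finset.smul_sum, Finset.smul_sum]
      refine Finset.sum_congr rfl fun k _ => ?_
      rw [smul_smul, smul_smul, mul_assoc]

lemma span_param_eq_of_mul_eq (e : Fin (n + 1) → V) {s r s' r' : K} (h : ¬ (s = 0 ∧ r = 0))
    (h' : ¬ (s' = 0 ∧ r' = 0)) (hp : s * r' = r * s') :
    span K {param e s r} = span K {param e s' r'} := by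
  obtain ⟨c, hc, rfl, rfl⟩ : ∃ c : K, c ≠ 0 ∧ s = c * s' ∧ r = c * r' := by
    by_cases hs : s' = 0
    · have hr : r' ≠ 0 := fun hr => h' ⟨hs, hr⟩
      have hs0 : s = 0 := by simpa [hs, hr] using hp
      refine ⟨r / r', div_ne_zero (fun hr => h ⟨hs0, hr⟩) hr, by simp [hs, hs0], ?_⟩
      rw [div_mul_cancel₀ _ hr]
    · have hs0 : s ≠ 0 := by
        rintro rfl
        refine h ⟨rfl, ?_⟩
        simpa [hs] using hp.symm
      refine ⟨s / s', div_ne_zero hs0 hs, (div_mul_cancel₀ _ hs).symm, ?_⟩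
      field_simp
      linear_combination -hp
  rw [param_mul, span_singleton_eq_iff]
  exact ⟨c ^ n, pow_ne_zero _ hc, rfl⟩

/-- A curve in standard form, together with parameters of points on it. -/
lemma exists_parameters {e : Fin (n + 1) → V} {ι : Type*} {X : ι → Projectivization K V}
    (hX : Function.Injective X) (h : ∀ i, X i ∈ curvePoints K e) :
    ∃ s r : ι → K, (∀ i, ¬ (s i = 0 ∧ r i = 0)) ∧
      (∀ i, (X i).submodule = span K {param e (s i) (r i)}) ∧
      ∀ i j, i ≠ j → s i * r j ≠ r i * s j := by
  have := fun i => mem_curvePoints.1 (h i)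
  choose s r hsr hs using this
  refine ⟨s, r, hsr, hs, fun i j hij hp => hij (hX ?_)⟩
  apply Projectivization.submodule_injective
  rw [hs, hs]
  exact span_param_eq_of_mul_eq e (hsr i) (hsr j) hp

/-- The points of the curve in coordinates with respect to `n + 1` of its points. -/
lemma param_eq_sum_prod_erase {e : Fin (n + 1) → V}
    {s r : Fin (n + 1) → K} (hsr : ∀ i j, i ≠ j → s i * r j ≠ r i * s j)
    {X : Fin (n + 1) → Projectivization K V}
    (hs : ∀ i, (X i).submodule = span K {param e (s i) (r i)}) :
    ∃ d : Fin (n + 1) → K, (∀ i, d i ≠ 0) ∧ ∀ x y, param e x y =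
      ∑ i, ((∏ j ∈ Finset.univ.erase i, (x * r j - y * s j)) * d i) • (X i).rep := by
  have : ∀ i, ∃ c : K, c ≠ 0 ∧ param e (s i) (r i) = c • (X i).rep := by
    intro i
    rw [← span_singleton_eq_iff, ← hs i, Projectivization.submodule_eq]
  choose c hc hce using this
  refine ⟨fun i => (∏ j ∈ Finset.univ.erase i, (s i * r j - r i * s j))⁻¹ * c i, fun i => ?_,
    fun x y => ?_⟩
  · refine mul_ne_zero (inv_ne_zero (Finset.prod_ne_zero_iff.2 fun j hj => ?_)) (hc i)
    exact sub_ne_zero.2 (hsr i j (Finset.ne_of_mem_erase hj).symm)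
  · rw [param_eq_sum_lagrange e hsr]
    refine Finset.sum_congr rfl fun i _ => ?_
    rw [hce, smul_smul, smul_smul, mul_assoc]

/-- Distinct points on a normal rational curve of order `n` are in general position. -/
lemma linearIndependent_rep_of_mem_curvePoints {e : Fin (n + 1) → V}
    (he : LinearIndependent K e) {X : Fin (n + 1) → Projectivization K V}
    (hX : Function.Injective X) (h : ∀ i, X i ∈ curvePoints K e) :
    LinearIndependent K fun i => (X i).rep := by
  obtain ⟨s, r, h0, hs, hsr⟩ := exists_parameters hX h
  rw [Fintype.linearIndependent_iff]
  intro g hg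
  have : ∀ i, ∃ c : K, c ≠ 0 ∧ (X i).rep = c • param e (s i) (r i) := by
    intro i
    rw [← span_singleton_eq_iff, ← hs i, Projectivization.submodule_eq]
  choose c hc hce using this
  have hdet : (Matrix.projVandermonde r s).det ≠ 0 := det_projVandermonde_ne_zero hsr
  -- In the coordinates given by `e`, a relation between the points is a left null vector of a
  -- Vandermonde matrix.
  have hz : Matrix.vecMul (fun i => g i * c i) (Matrix.projVandermonde r s) = 0 := by
    rw [Fintype.linearIndependent_iff] at he
    ext k
    refine he (fun k => Matrix.vecMul (fun i => g i * c i) (Matrix.projVandermonde r s) k) ?_ k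
    rw [← hg]
    simp only [Matrix.vecMul, dotProduct, Finset.sum_smul]
    rw [Finset.sum_comm]
    refine Finset.sum_congr rfl fun i _ => ?_
    rw [hce, param, Finset.smul_sum, Finset.smul_sum]
    refine Finset.sum_congr rfl fun k _ => ?_
    rw [smul_smul, smul_smul, Matrix.projVandermonde_apply]
    congr 1
    ring
  have := Matrix.eq_zero_of_vecMul_eq_zero hdet hz
  intro i
  simpa [hc i] using congrFun this i

/-- Through `n + 3` points there is at most one normal rational curve of order `n`. -/
theorem curvePoints_subset_of_common_points {e e' : Fin (n + 1) → V}
    (he : LinearIndependent K e)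
    {X : Option (Option (Fin (n + 1))) → Projectivization K V} (hX : Function.Injective X)
    (h : ∀ i, X i ∈ curvePoints K e) (h' : ∀ i, X i ∈ curvePoints K e') :
    (curvePoints K e : Set (Projectivization K V)) ⊆ curvePoints K e' := by
  obtain ⟨s, r, h0, hs, hsr⟩ := exists_parameters hX h
  obtain ⟨s', r', h0', hs', hsr'⟩ := exists_parameters hX h'
  have hp : LinearIndependent K fun i => (X (some (some i))).rep :=
    linearIndependent_rep_of_mem_curvePoints (e := e) he (X := fun i => X (some (some i)))
    (hX.comp ((Option.some_injective _).comp (Option.some_injective _))) (fun i => h (some (some i)))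
  obtain ⟨d, hd, hde⟩ := param_eq_sum_prod_erase (K := K) (V := V) (e := e)
    (X := fun i => X (some (some i))) (s := fun i => s (some (some i)))
    (r := fun i => r (some (some i))) (fun i j hij => hsr _ _ (by simpa using hij))
    (fun i => hs (some (some i)))
  obtain ⟨d', hd', hde'⟩ := param_eq_sum_prod_erase (K := K) (V := V) (e := e')
    (X := fun i => X (some (some i))) (s := fun i => s' (some (some i)))
    (r := fun i => r' (some (some i))) (fun i j hij => hsr' _ _ (by simpa using hij))
    (fun i => hs' (some (some i)))
  set L : K → K → Fin (n + 1) → K :=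
    fun x y i => x * r (some (some i)) - y * s (some (some i)) with hL
  set L' : K → K → Fin (n + 1) → K :=
    fun x y i => x * r' (some (some i)) - y * s' (some (some i)) with hL'
  -- the two further points
  have aux : ∀ o : Option (Option (Fin (n + 1))), (∀ i, o ≠ some (some i)) →
      ∃ a : K, a ≠ 0 ∧ ∀ i, d' i * L (s o) (r o) i = a * (d i * L' (s' o) (r' o) i) := by
    intro o ho
    have hLn : ∀ i, L (s o) (r o) i ≠ 0 := fun i => sub_ne_zero.2 (hsr _ _ (ho i))
    have hLn' : ∀ i, L' (s' o) (r' o) i ≠ 0 := fun i => sub_ne_zero.2 (hsr' _ _ (ho i))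
    have h1 := (hs o).symm.trans (hs' o)
    rw [span_singleton_eq_iff] at h1
    obtain ⟨c, hc, h1⟩ := h1
    rw [hde, hde', Finset.smul_sum] at h1
    simp only [smul_smul] at h1
    have h2 : ∀ i, (∏ j ∈ Finset.univ.erase i, L (s o) (r o) j) * d i =
        c * ((∏ j ∈ Finset.univ.erase i, L' (s' o) (r' o) j) * d' i) := fun i => by
      have := Fintype.linearIndependent_iff.1 hp _ ((by
        simp only [sub_smul, Finset.sum_sub_distrib]; exact sub_eq_zero.2 h1) :
        ∑ i, ((∏ j ∈ Finset.univ.erase i, L (s o) (r o) j) * d i -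
        c * ((∏ j ∈ Finset.univ.erase i, L' (s' o) (r' o) j) * d' i)) • (X (some (some i))).rep = 0) i
      exact sub_eq_zero.1 this
    -- In coordinates based at `n + 1` of the points, the curve has `i`-th coordinate proportional
    -- to `d i / L i`. Multiplying `h2` by `L i * L' i` restores the full products and leaves a
    -- relation that is linear in `L` and `L'`.
    have hP : (∏ j, L (s o) (r o) j) ≠ 0 := Finset.prod_ne_zero_iff.2 fun j _ => hLn j
    have hP' : (∏ j, L' (s' o) (r' o) j) ≠ 0 := Finset.prod_ne_zero_iff.2 fun j _ => hLn' j
    refine ⟨(∏ j, L (s o) (r o) j) / (c * ∏ j, L' (s' o) (r' o) j),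
      div_ne_zero hP (mul_ne_zero hc hP'), fun i => ?_⟩
    have e1 := Finset.mul_prod_erase Finset.univ (L (s o) (r o)) (Finset.mem_univ i)
    have e2 := Finset.mul_prod_erase Finset.univ (L' (s' o) (r' o)) (Finset.mem_univ i)
    rw [div_mul_eq_mul_div, eq_div_iff (mul_ne_zero hc hP'), ← e1, ← e2]
    linear_combination (-L (s o) (r o) i * L' (s' o) (r' o) i) * h2 i
  obtain ⟨a, ha, hQ⟩ := aux none (by simp)
  obtain ⟨b, hb, hR⟩ := aux (some none) (by simp)
  have hQR := hsr none (some none) (by simp)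
  have hQR' := hsr' none (some none) (by simp)
  intro Y hY
  rw [mem_curvePoints] at hY ⊢
  obtain ⟨x, y, hxy, hY⟩ := hY
  simp only [Algebra.algebraMap_self, RingHom.id_apply] at hY ⊢
  set sQ := s none
  set rQ := r none
  set sR := s (some none)
  set rR := r (some none)
  have hΔ : sQ * rR - rQ * sR ≠ 0 := sub_ne_zero.2 hQR
  -- `(x, y)` in terms of the parameters of the two further points
  set m := (x * rR - y * sR) / (sQ * rR - rQ * sR) with hm
  set k := (y * sQ - x * rQ) / (sQ * rR - rQ * sR) with hk
  have hmΔ : m * (sQ * rR - rQ * sR) = x * rR - y * sR := div_mul_cancel₀ _ hΔ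
  have hkΔ : k * (sQ * rR - rQ * sR) = y * sQ - x * rQ := div_mul_cancel₀ _ hΔ
  have hx : x = m * sQ + k * sR := mul_right_cancel₀ hΔ (by
    linear_combination -sQ * hmΔ - sR * hkΔ)
  have hy : y = m * rQ + k * rR := mul_right_cancel₀ hΔ (by
    linear_combination -rQ * hmΔ - rR * hkΔ)
  -- The relations `hQ` and `hR` at the two further points extend linearly, so this is the linear
  -- change of parameters taking one curve to the other.
  set x' := m * a * s' none + k * b * s' (some none) with hx'
  set y' := m * a * r' none + k * b * r' (some none) with hy'
  have hlin : ∀ i, d' i * L x y i = d i * L' x' y' i := by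
    intro i
    have h1 := hQ i
    have h2 := hR i
    simp only [hL, hL'] at h1 h2 ⊢
    rw [hx', hy']
    nth_rewrite 1 [hx]
    nth_rewrite 1 [hy]
    linear_combination m * h1 + k * h2
  have hne : ¬ (x' = 0 ∧ y' = 0) := by
    rintro ⟨h1, h2⟩
    apply hxy
    have h3 : m * a * (s' none * r' (some none) - r' none * s' (some none)) = 0 := by
      linear_combination r' (some none) * (hx'.symm.trans h1) - s' (some none) * (hy'.symm.trans h2)
    have h4 : k * b * (s' none * r' (some none) - r' none * s' (some none)) = 0 := by
      linear_combination s' none * (hy'.symm.trans h2) - r' none * (hx'.symm.trans h1)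
    have h5 := sub_ne_zero.2 hQR'
    have hm0 : m = 0 := by simpa [ha, h5] using h3
    have hk0 : k = 0 := by simpa [hb, h5] using h4
    rw [hx, hy, hm0, hk0]
    simp
  refine ⟨x', y', hne, ?_⟩
  rw [hY, span_singleton_eq_iff]
  refine ⟨(∏ j, d j) / ∏ j, d' j, div_ne_zero (Finset.prod_ne_zero_iff.2 fun j _ => hd j)
    (Finset.prod_ne_zero_iff.2 fun j _ => hd' j), ?_⟩
  rw [hde, hde', Finset.smul_sum]
  refine Finset.sum_congr rfl fun i _ => ?_
  rw [smul_smul]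
  congr 1
  have hD' : (∏ j, d' j) ≠ 0 := Finset.prod_ne_zero_iff.2 fun j _ => hd' j
  have e3 : (∏ j ∈ Finset.univ.erase i, d' j) * ∏ j ∈ Finset.univ.erase i, L x y j =
      (∏ j ∈ Finset.univ.erase i, d j) * ∏ j ∈ Finset.univ.erase i, L' x' y' j := by
    rw [← Finset.prod_mul_distrib, ← Finset.prod_mul_distrib]
    exact Finset.prod_congr rfl fun j _ => hlin j
  change (∏ j ∈ Finset.univ.erase i, L x y j) * d i = _ *
    ((∏ j ∈ Finset.univ.erase i, L' x' y' j) * d' i)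
  rw [div_mul_eq_mul_div, eq_div_iff hD', ← Finset.mul_prod_erase Finset.univ d (Finset.mem_univ i),
    ← Finset.mul_prod_erase Finset.univ d' (Finset.mem_univ i)]
  linear_combination d i * d' i * e3

end Param

/-! ### Cyclic extensions of prime degree: fixed field, Hilbert 90, and products over partial
orbits. -/

section Galois

variable {F K : Type*} [Field F] [Field K] [Algebra F K]

/-- Primality of the degree enters here: every nontrivial automorphism is a generator, so the
results below apply to `τⁿ` as well as to `τ`. -/
lemma mem_zpowers_of_prime_finrank [FiniteDimensional F K] [IsGalois F K]
    (hp : (Module.finrank F K).Prime) {g : Gal(K/F)} (hg : g ≠ 1) (x : Gal(K/F)) :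
    x ∈ Subgroup.zpowers g := by
  have : Fact (Module.finrank F K).Prime := ⟨hp⟩
  exact mem_zpowers_of_prime_card (IsGalois.card_aut_eq_finrank F K) hg

lemma orderOf_eq_finrank_of_prime [FiniteDimensional F K] [IsGalois F K]
    (hp : (Module.finrank F K).Prime) {g : Gal(K/F)} (hg : g ≠ 1) :
    orderOf g = Module.finrank F K := by
  have : Fact (Module.finrank F K).Prime := ⟨hp⟩
  apply orderOf_eq_prime _ hg
  rw [← IsGalois.card_aut_eq_finrank F K]
  exact pow_card_eq_one'

lemma mem_range_algebraMap_of_fixed [FiniteDimensional F K] [IsGalois F K]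
    (hp : (Module.finrank F K).Prime) {g : Gal(K/F)} (hg : g ≠ 1) {x : K} (hx : g x = x) :
    ∃ c : F, algebraMap F K c = x := by
  refine (IsGalois.mem_range_algebraMap_iff_fixed x).2 fun f => ?_
  have h1 : g ∈ MulAction.stabilizer Gal(K/F) x := hx
  have h2 : Subgroup.zpowers g ≤ MulAction.stabilizer Gal(K/F) x := by
    rwa [Subgroup.zpowers_le]
  exact h2 (mem_zpowers_of_prime_finrank hp hg f)

lemma norm_eq_prod_pow [FiniteDimensional F K] [IsGalois F K]
    (hp : (Module.finrank F K).Prime) {g : Gal(K/F)} (hg : g ≠ 1) (x : K) :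
    algebraMap F K (Algebra.norm F x) =
      ∏ i ∈ Finset.range (Module.finrank F K), (g ^ i) x := by
  classical
  have hord := orderOf_eq_finrank_of_prime hp hg
  have hinj : Set.InjOn (fun i : ℕ => g ^ i) (Finset.range (Module.finrank F K)) := by
    intro i hi j hj h
    rw [← hord] at hi hj
    exact pow_injOn_Iio_orderOf (by simpa using hi) (by simpa using hj) h
  have huniv : (Finset.range (Module.finrank F K)).image (fun i : ℕ => g ^ i) = Finset.univ := by
    apply Finset.eq_univ_of_card
    rw [Finset.card_image_of_injOn hinj, Finset.card_range, ← Nat.card_eq_fintype_card,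
      IsGalois.card_aut_eq_finrank]
  rw [Algebra.norm_eq_prod_automorphisms, ← huniv, Finset.prod_image hinj]

/-- Hilbert's Theorem 90 for cyclic extensions of prime degree. -/
lemma exists_eq_div_of_norm_eq_one [FiniteDimensional F K] [IsGalois F K]
    (hp : (Module.finrank F K).Prime) {g : Gal(K/F)} (hg : g ≠ 1) {k : K}
    (hk : Algebra.norm F k = 1) : ∃ κ : K, κ ≠ 0 ∧ k * κ = g κ := by
  set t := Module.finrank F K with ht
  have hord : orderOf g = t := orderOf_eq_finrank_of_prime hp hg
  have hk0 : k ≠ 0 := by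
    rintro rfl
    rw [Algebra.norm_zero] at hk
    exact zero_ne_one hk
  -- Inverse partial norms of `k`. They satisfy `k⁻¹ g(c i) = c (i + 1)`, and `c t = c 0` because
  -- the norm of `k` is `1`.
  let c : ℕ → K := fun i => ∏ j ∈ Finset.range i, ((g ^ j) k)⁻¹
  have hc : ∀ i, k⁻¹ * g (c i) = c (i + 1) := by
    intro i
    simp only [c]
    rw [Finset.prod_range_succ', map_prod, mul_comm]
    congr 1
    refine Finset.prod_congr rfl fun j _ => ?_
    rw [map_inv₀, pow_succ']
    rfl
  have hct : c t = 1 := by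
    simp only [c]
    rw [Finset.prod_inv_distrib, ← norm_eq_prod_pow hp hg, hk, map_one, inv_one]
  have hli : LinearIndependent K fun i : Fin t => ((g ^ (i : ℕ) : Gal(K/F)) : K → K) := by
    have h1 : LinearIndependent K (fun f : K →* K => (f : K → K)) := linearIndependent_monoidHom K K
    refine h1.comp (fun i : Fin t => ((g ^ (i : ℕ) : Gal(K/F)) : K →* K)) ?_
    intro i j hij
    have : g ^ (i : ℕ) = g ^ (j : ℕ) := by
      ext x
      exact DFunLike.congr_fun hij x
    ext
    exact pow_injOn_Iio_orderOf (by simp [hord]) (by simp [hord]) this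
  -- Independence of the distinct characters `gⁱ` gives a nonzero value of the resolvent, which
  -- serves as `κ`. The operator `x ↦ k⁻¹ g(x)` permutes its summands cyclically.
  obtain ⟨z, hz⟩ : ∃ z, ∑ i ∈ Finset.range t, c i * (g ^ i) z ≠ 0 := by
    by_contra! hall
    rw [Fintype.linearIndependent_iff] at hli
    have := hli (fun i => c i) (by
      ext z
      rw [Finset.sum_apply, Pi.zero_apply, ← hall z, Finset.sum_range]
      rfl) ⟨0, hp.pos⟩
    simp [c] at this
  refine ⟨_, hz, ?_⟩
  rw [← mul_right_inj' (inv_ne_zero hk0), inv_mul_cancel_left₀ hk0, map_sum, Finset.mul_sum]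
  have hgt : g ^ t = 1 := by rw [← hord, pow_orderOf_eq_one]
  have hstep : ∀ i, k⁻¹ * g (c i * (g ^ i) z) = c (i + 1) * (g ^ (i + 1)) z := by
    intro i
    rw [map_mul, ← mul_assoc, hc, pow_succ']
    rfl
  simp only [hstep]
  have hlast : c t * (g ^ t) z = c 0 * (g ^ 0) z := by
    rw [hct, hgt, pow_zero]
    simp [c]
  have h1 := Finset.sum_range_succ' (fun i => c i * (g ^ i) z) t
  rw [Finset.sum_range_succ, hlast] at h1
  exact add_right_cancel h1

/-- This is a 2 × 2 Moore determinant: were it zero, `g` would fix `a / b`, which would then lie in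
`F`. -/
lemma mul_map_sub_mul_map_ne_zero [FiniteDimensional F K] [IsGalois F K]
    (hp : (Module.finrank F K).Prime) {g : Gal(K/F)} (hg : g ≠ 1) {a b : K}
    (hab : LinearIndependent F ![a, b]) : a * g b - b * g a ≠ 0 := by
  intro h0
  rw [LinearIndependent.pair_iff] at hab
  have hb : b ≠ 0 := by
    rintro rfl
    have := hab 0 1 (by simp)
    exact one_ne_zero this.2
  have hgb : g b ≠ 0 := (map_ne_zero _).2 hb
  obtain ⟨c, hc⟩ := mem_range_algebraMap_of_fixed hp hg (x := a / b) (by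
    rw [map_div₀, div_eq_div_iff hgb hb]
    linear_combination -h0)
  have := hab 1 (-c) (by
    rw [Algebra.smul_def, Algebra.smul_def, map_neg, hc]
    field_simp
    simp)
  exact one_ne_zero this.1

/-- The polynomials whose coefficients define the curve. -/
noncomputable def orbitPoly (g : Gal(K/F)) (a b : K) (n : ℕ) : Polynomial K :=
  ∏ i ∈ Finset.range n, (Polynomial.C ((g ^ i) a) + Polynomial.C ((g ^ i) b) * Polynomial.X)

lemma param_orbitPoly (g : Gal(K/F)) (a b : K) (n : ℕ) (s r : K) :
    param (fun k : Fin (n + 1) => (orbitPoly g a b n).coeff k) s r =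
      ∏ i ∈ Finset.range n, (s * (g ^ i) a + r * (g ^ i) b) :=
  param_coeff_prod_linear _ (by simp) _ _ _ _

/-- An `F`-linear relation between the coefficients of `orbitPoly` is trivial. -/
lemma orbitPoly_coeff_relation [FiniteDimensional F K] [IsGalois F K]
    (hp : (Module.finrank F K).Prime) {g : Gal(K/F)} (hg : g ≠ 1) {a b : K}
    (hab : LinearIndependent F ![a, b]) :
    ∀ n, n < Module.finrank F K → ∀ β : ℕ → F,
      ∑ k ∈ Finset.range (n + 1), β k • (orbitPoly g a b n).coeff k = 0 → ∀ k ≤ n, β k = 0 := by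
  have hord := orderOf_eq_finrank_of_prime hp hg
  have hdet : ∀ n, n + 1 < Module.finrank F K → a * (g ^ (n + 1)) b - b * (g ^ (n + 1)) a ≠ 0 := by
    intro n hn
    refine mul_map_sub_mul_map_ne_zero hp (fun h1 => ?_) hab
    have := orderOf_le_of_pow_eq_one (Nat.succ_pos n) h1
    omega
  have hdeg : ∀ n, (orbitPoly g a b n).coeff (n + 1) = 0 := by
    intro n
    apply Polynomial.coeff_eq_zero_of_natDegree_lt
    refine lt_of_le_of_lt (Polynomial.natDegree_prod_le _ _) ?_
    refine lt_of_le_of_lt (Finset.sum_le_card_nsmul _ _ 1 fun j _ => ?_) (by simp)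
    compute_degree
  have hsplit : ∀ (n : ℕ) (G : Polynomial K) (α γ : K) (β : ℕ → F), G.coeff (n + 1) = 0 →
      ∑ k ∈ Finset.range (n + 1 + 1), β k •
        ((Polynomial.C α + Polynomial.C γ * Polynomial.X) * G).coeff k =
      α * ∑ k ∈ Finset.range (n + 1), β k • G.coeff k +
        γ * ∑ k ∈ Finset.range (n + 1), β (k + 1) • G.coeff k := by
    intro n G α γ β hG
    have e1 : ∑ k ∈ Finset.range (n + 1), β k • G.coeff k =
        ∑ k ∈ Finset.range (n + 1 + 1), β k • G.coeff k := by
      rw [Finset.sum_range_succ _ (n + 1), hG, smul_zero, add_zero]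
    have e2 : ∑ k ∈ Finset.range (n + 1), β (k + 1) • G.coeff k =
        ∑ k ∈ Finset.range (n + 1 + 1), β k • (Polynomial.X * G).coeff k := by
      rw [Finset.sum_range_succ' _ (n + 1), Polynomial.coeff_X_mul_zero, smul_zero, add_zero]
      simp only [Polynomial.coeff_X_mul]
    rw [e1, e2, Finset.mul_sum, Finset.mul_sum, ← Finset.sum_add_distrib]
    refine Finset.sum_congr rfl fun k _ => ?_
    rw [add_mul, Polynomial.coeff_add, Polynomial.coeff_C_mul, mul_assoc (Polynomial.C _),
      Polynomial.coeff_C_mul, smul_add, mul_smul_comm, mul_smul_comm]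
  have hmap : ∀ n, (orbitPoly g a b n).map (g : K →+* K) = ∏ i ∈ Finset.range n,
      (Polynomial.C ((g ^ (i + 1)) a) + Polynomial.C ((g ^ (i + 1)) b) * Polynomial.X) := by
    intro n
    rw [orbitPoly, Polynomial.map_prod]
    refine Finset.prod_congr rfl fun i _ => ?_
    simp [pow_succ']
  intro n
  induction n with
  | zero =>
    intro _ β h k hk
    obtain rfl : k = 0 := by omega
    simpa [orbitPoly] using h
  | succ n ih =>
    intro hn β h
    set G := orbitPoly g a b n with hG
    set H := G.map (g : K →+* K) with hH
    have hHdeg : H.coeff (n + 1) = 0 := by rw [hH, Polynomial.coeff_map, hdeg, map_zero]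
    -- The polynomial and its image under `g` share the factor `H` and differ in one linear factor
    -- each. As `g` fixes the `β k`, the relation and its conjugate become two linear equations in
    -- `A` and `B`.
    have e1 : orbitPoly g a b (n + 1) =
        (Polynomial.C a + Polynomial.C b * Polynomial.X) * H := by
      rw [hH, hmap, orbitPoly, Finset.prod_range_succ', mul_comm]
      simp
    have e2 : (orbitPoly g a b (n + 1)).map (g : K →+* K) =
        (Polynomial.C ((g ^ (n + 1)) a) + Polynomial.C ((g ^ (n + 1)) b) * Polynomial.X) * H := by
      rw [hH, hmap, hmap, Finset.prod_range_succ, mul_comm]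
    have h' : ∑ k ∈ Finset.range (n + 1 + 1),
        β k • ((orbitPoly g a b (n + 1)).map (g : K →+* K)).coeff k = 0 := by
      have := congrArg g h
      rw [map_sum, map_zero] at this
      rw [← this]
      refine Finset.sum_congr rfl fun k _ => ?_
      rw [map_smul, Polynomial.coeff_map]
      rfl
    rw [e1, hsplit _ _ _ _ _ hHdeg] at h
    rw [e2, hsplit _ _ _ _ _ hHdeg] at h'
    -- The determinant of this system is nonzero because `gⁿ⁺¹ ≠ 1`. So `β` and its shift are both
    -- relations between the coefficients of `H`, hence of `G`, and induction applies to each.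
    have hd := hdet n hn
    set A := ∑ k ∈ Finset.range (n + 1), β k • H.coeff k with hA
    set B := ∑ k ∈ Finset.range (n + 1), β (k + 1) • H.coeff k with hB
    have hA0 : A = 0 := by
      have : (a * (g ^ (n + 1)) b - b * (g ^ (n + 1)) a) * A = 0 := by
        linear_combination (g ^ (n + 1)) b * h - b * h'
      exact (mul_eq_zero.1 this).resolve_left hd
    have hB0 : B = 0 := by
      have : (a * (g ^ (n + 1)) b - b * (g ^ (n + 1)) a) * B = 0 := by
        linear_combination a * h' - (g ^ (n + 1)) a * h
      exact (mul_eq_zero.1 this).resolve_left hd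
    have hback : ∀ γ : ℕ → F, ∑ k ∈ Finset.range (n + 1), γ k • H.coeff k = 0 →
        ∑ k ∈ Finset.range (n + 1), γ k • G.coeff k = 0 := by
      intro γ hγ
      apply g.injective
      rw [map_zero, map_sum, ← hγ]
      refine Finset.sum_congr rfl fun k _ => ?_
      rw [map_smul, hH, Polynomial.coeff_map]
      rfl
    intro k hk
    rcases Nat.eq_zero_or_pos k with rfl | hpos
    · exact ih (by omega) β (hback β (hA.symm.trans hA0)) 0 (Nat.zero_le _)
    · have := ih (by omega) (fun k => β (k + 1)) (hback _ (hB.symm.trans hB0)) (k - 1) (by omega)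
      simpa [Nat.sub_add_cancel hpos] using this

lemma linearIndependent_orbitPoly_coeff [FiniteDimensional F K] [IsGalois F K]
    (hp : (Module.finrank F K).Prime) {g : Gal(K/F)} (hg : g ≠ 1) {a b : K}
    (hab : LinearIndependent F ![a, b]) {n : ℕ} (hn : n < Module.finrank F K) :
    LinearIndependent F fun k : Fin (n + 1) => (orbitPoly g a b n).coeff k := by
  rw [Fintype.linearIndependent_iff]
  intro β h i
  have := orbitPoly_coeff_relation hp hg hab n hn
    (fun k => if hk : k < n + 1 then β ⟨k, hk⟩ else 0) (by
      rw [Finset.sum_range, ← h]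
      refine Finset.sum_congr rfl fun k _ => ?_
      rw [dif_pos k.isLt]) i (Nat.lt_succ_iff.1 i.isLt)
  rwa [dif_pos i.isLt] at this

/-- The elements `μ` for which `g μ / μ` is the quotient `gⁿ y / y`. -/
lemma map_mul_eq_iff_prod_orbit [FiniteDimensional F K] [IsGalois F K]
    (hp : (Module.finrank F K).Prime) {g : Gal(K/F)} (hg : g ≠ 1) {y : K} (hy : y ≠ 0) (n : ℕ)
    {μ : K} : μ * (g ^ n) y = g μ * y ↔
      ∃ c : F, μ = algebraMap F K c * ∏ i ∈ Finset.range n, (g ^ i) y := by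
  set M := ∏ i ∈ Finset.range n, (g ^ i) y with hM
  have hM0 : M ≠ 0 := Finset.prod_ne_zero_iff.2 fun i _ => (map_ne_zero _).2 hy
  -- Telescoping: `g` shifts the product by one factor.
  have key : M * (g ^ n) y = g M * y := by
    rw [hM, ← Finset.prod_range_succ, Finset.prod_range_succ', map_prod]
    simp only [pow_succ', AlgEquiv.mul_apply, pow_zero, AlgEquiv.one_apply]
  have hgM : g M ≠ 0 := by simpa using hM0
  constructor
  · intro h
    -- Two solutions of the equation have a quotient fixed by `g`.
    obtain ⟨c, hc⟩ := mem_range_algebraMap_of_fixed hp hg (x := μ / M) (by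
      rw [map_div₀, div_eq_div_iff hgM hM0]
      apply mul_right_cancel₀ hy
      linear_combination -M * h + μ * key)
    exact ⟨c, by rw [hc, div_mul_cancel₀ _ hM0]⟩
  · rintro ⟨c, rfl⟩
    rw [map_mul, AlgEquiv.commutes]
    linear_combination algebraMap F K c * key

end Galois

/-! ### Iterates of a semilinear map. -/

section Semilinear

variable {F K V : Type*} [Field F] [Field K] [Algebra F K] [AddCommGroup V]
  [Module K V] {τ : Gal(K/F)} (φ : V →ₛₗ[(τ : K →+* K)] V)

lemma iterate_semilinear_smul (m : ℕ) (c : K) (x : V) :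
    (⇑φ)^[m] (c • x) = (τ ^ m) c • (⇑φ)^[m] x := by
  induction m with
  | zero => simp
  | succ m ih =>
    rw [Function.iterate_succ_apply', ih, Function.iterate_succ_apply', map_smulₛₗ, pow_succ']
    rfl

lemma iterate_semilinear_add (m : ℕ) (x y : V) :
    (⇑φ)^[m] (x + y) = (⇑φ)^[m] x + (⇑φ)^[m] y := by
  induction m with
  | zero => simp
  | succ m ih => simp only [Function.iterate_succ_apply', ih, map_add]

lemma iterate_semilinear_sum {ι : Type*} (m : ℕ) (s : Finset ι) (f : ι → V) :
    (⇑φ)^[m] (∑ i ∈ s, f i) = ∑ i ∈ s, (⇑φ)^[m] (f i) := by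
  induction m with
  | zero => simp
  | succ m ih => simp only [Function.iterate_succ_apply', ih, map_sum]

end Semilinear

/-! ### The canonical subgeometry as a copy of `K`, and its projection to the axis. -/

section Subgeometry

variable {F K V : Type*} [Field F] [Field K] [Algebra F K] [AddCommGroup V] [Module F V]
  [Module K V] [IsScalarTower F K V]

/-- Extend the family to an `F`-basis of `W`. This basis spans `V` over `K` and has as many members
as the dimension of `V`, so it is independent over `K`. -/
lemma IsCanonical.linearIndependent [FiniteDimensional K V] {W : Submodule F V}
    (hW : IsCanonical K W) {ι : Type*}
    {w : ι → V} (hw : ∀ i, w i ∈ W) (hli : LinearIndependent F w) : LinearIndependent K w := by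
  rcases Nat.eq_zero_or_pos (Module.finrank K V) with h0 | hpos
  · have : Subsingleton V := Module.finrank_zero_iff.1 h0
    have : IsEmpty ι := ⟨fun i => hli.ne_zero i (Subsingleton.elim _ _)⟩
    exact linearIndependent_empty_type
  have hfin : FiniteDimensional F W := FiniteDimensional.of_finrank_pos (hW.1 ▸ hpos)
  let w' : ι → W := fun i => ⟨w i, hw i⟩
  have hli' : LinearIndependent F w' := LinearIndependent.of_comp W.subtype hli
  have hs : LinearIndepOn F id (Set.range w') := hli'.linearIndepOn_id
  let b := Module.Basis.extend hs
  have hb : ∀ x, (b x : W) = x := fun x => Module.Basis.extend_apply_self hs x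
  have : Fintype (hs.extend (Set.subset_univ (Set.range w'))) :=
    FiniteDimensional.fintypeBasisIndex b
  have hspan : ⊤ ≤ span K (Set.range fun x => ((b x : W) : V)) := by
    rw [← hW.2, span_le]
    intro v hv
    have h1 : (⟨v, hv⟩ : W) ∈ span F (Set.range b) := b.mem_span _
    have h2 : v ∈ span F (Set.range fun x => ((b x : W) : V)) := by
      have := Submodule.mem_map_of_mem (f := W.subtype) h1
      rwa [Submodule.map_span, ← Set.range_comp] at this
    exact Submodule.span_le_restrictScalars F K _ h2
  have hK := linearIndependent_of_top_le_span_of_card_eq_finrank (R := K) hspan (by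
    rw [← Module.finrank_eq_card_basis b, hW.1])
  have hinj : Function.Injective fun i : ι =>
      (⟨w' i, hs.subset_extend _ ⟨i, rfl⟩⟩ : hs.extend (Set.subset_univ (Set.range w'))) :=
    fun i j hij => hli'.injective (by simpa using hij)
  have := hK.comp _ hinj
  convert this using 1
  ext i
  simp [hb, w']

variable {τ : Gal(K/F)} (φ : V →ₛₗ[(τ : K →+* K)] V)

omit [IsScalarTower F K V] in
/-- A semilinear map that fixes a canonical subgeometry has the order of its automorphism. -/
lemma iterate_eq_self {W : Submodule F V} (hW : IsCanonical K W) (hφ : ∀ w ∈ W, φ w = w) {m : ℕ}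
    (hm : τ ^ m = 1) (v : V) : (⇑φ)^[m] v = v := by
  have hv : v ∈ span K (W : Set V) := by rw [hW.2]; trivial
  induction hv using Submodule.span_induction with
  | mem x hx => exact Function.iterate_fixed (hφ x hx) m
  | zero => simp
  | add x y _ _ hx hy => rw [iterate_semilinear_add, hx, hy]
  | smul c x _ hx => rw [iterate_semilinear_smul, hx, hm]; rfl

/-- The map `x ↦ ∑ τⁱ(x) φⁱ(P)` over an orbit. -/
def orbitMap (P : V) (n : ℕ) : K →ₗ[F] V where
  toFun x := ∑ i ∈ Finset.range n, (τ ^ i) x • (⇑φ)^[i] P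
  map_add' x y := by simp only [map_add, add_smul, Finset.sum_add_distrib]
  map_smul' c x := by
    simp only [map_smul, smul_assoc, RingHom.id_apply, Finset.smul_sum]

lemma orbitMap_apply (P : V) (n : ℕ) (x : K) :
    orbitMap φ P n x = ∑ i ∈ Finset.range n, (τ ^ i) x • (⇑φ)^[i] P := rfl

/-- A vector `v = φ(v)` has coordinates satisfying `c (i + 1) = τ (c i)`, so it lies in the range;
equality follows by comparing dimensions. -/
lemma range_orbitMap {n : ℕ} [FiniteDimensional F K] (hK : Module.finrank F K = n + 1)
    (hV : Module.finrank K V = n + 1) {W : Submodule F V} (hW : IsCanonical K W)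
    (hτ : τ ^ (n + 1) = 1) (hφ : ∀ w ∈ W, φ w = w) {P : V}
    (hP : LinearIndependent K fun i : Fin (n + 1) => (⇑φ)^[(i : ℕ)] P)
    (hP' : span K (Set.range fun i : Fin (n + 1) => (⇑φ)^[(i : ℕ)] P) = ⊤) :
    (orbitMap φ P (n + 1)).range = W := by
  symm
  apply Submodule.eq_of_le_of_finrank_le
  · intro v hv
    have hvs : v ∈ span K (Set.range fun i : Fin (n + 1) => (⇑φ)^[(i : ℕ)] P) := by
      rw [hP']; trivial
    obtain ⟨c, hc⟩ := (Submodule.mem_span_range_iff_exists_fun K).1 hvs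
    -- Coordinates of `φ v`: those of `v` with `τ` applied, shifted cyclically.
    let d : Fin (n + 1) → K := Fin.cons (τ (c (Fin.last n))) fun i => τ (c i.castSucc)
    have hd : ∑ i, d i • (⇑φ)^[(i : ℕ)] P = v := by
      rw [← hφ v hv, ← hc, map_sum, Fin.sum_univ_succ, Fin.sum_univ_castSucc (n := n), add_comm]
      have hl : φ ((⇑φ)^[n] P) = P := by
        rw [← Function.iterate_succ_apply' (⇑φ)]
        exact iterate_eq_self φ hW hφ hτ P
      simp only [d, Fin.cons_succ, Fin.cons_zero, map_smulₛₗ, Fin.val_castSucc, Fin.val_succ,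
        Fin.val_last, Function.iterate_succ_apply', hl]
      rfl
    have hcd : c = d := by
      have := Fintype.linearIndependent_iff.1 hP (fun i => c i - d i) (by
        simp only [sub_smul, Finset.sum_sub_distrib]
        rw [hc, hd, sub_self])
      ext i
      exact sub_eq_zero.1 (this i)
    have hci : ∀ i : Fin (n + 1), c i = (τ ^ (i : ℕ)) (c 0) := by
      intro i
      induction i using Fin.induction with
      | zero => simp
      | succ i ih =>
        have : c i.succ = d i.succ := congrFun hcd _
        rw [this, Fin.val_succ, pow_succ', AlgEquiv.mul_apply]
        simp only [d, Fin.cons_succ, ih, Fin.val_castSucc]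
    refine ⟨c 0, ?_⟩
    rw [orbitMap_apply, Finset.sum_range, ← hc]
    exact Finset.sum_congr rfl fun i _ => by rw [hci i]
  · rw [hW.1, hV, ← hK]
    exact LinearMap.finrank_range_le _

/-- Modulo `Γ` the vectors `w` and `y` agree; the modular law then removes `Γ`. -/
lemma sup_span_inf_eq {Γ ℓ₀ : Submodule K V} (h : Disjoint Γ ℓ₀) {w y : V} (hy : y ∈ ℓ₀)
    (hwy : w - y ∈ Γ) : (Γ ⊔ span K {w}) ⊓ ℓ₀ = span K {y} := by
  have h1 : Γ ⊔ span K {w} = span K {y} ⊔ Γ := by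
    rw [sup_comm]
    apply le_antisymm
    · refine sup_le ?_ le_sup_right
      rw [span_singleton_le_iff_mem, ← sub_add_cancel w y]
      exact add_mem (mem_sup_right hwy) (mem_sup_left (mem_span_singleton_self y))
    · refine sup_le ?_ le_sup_right
      rw [span_singleton_le_iff_mem, ← sub_sub_cancel w y]
      exact sub_mem (mem_sup_left (mem_span_singleton_self w)) (mem_sup_right hwy)
  have h2 : span K {y} ≤ ℓ₀ := by rwa [span_singleton_le_iff_mem]
  rw [h1, sup_inf_assoc_of_le _ h2, h.eq_bot, sup_bot_eq]

/-- A parametrization `u` of the subgeometry by `K` such that `⟨u μ⟩` is projected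
to `⟨μ v₁ + τ(μ) v₂⟩`. -/
theorem exists_parametrization {m : ℕ} [FiniteDimensional F K]
    (hK : Module.finrank F K = m + 2) (hV : Module.finrank K V = m + 2)
    {W : Submodule F V} (hW : IsCanonical K W) (hτ : τ ^ (m + 2) = 1) (hφ : ∀ w ∈ W, φ w = w)
    {P : V} (hP : span K (Set.range fun i : Fin (m + 2) => (⇑φ)^[(i : ℕ)] P) = ⊤)
    {Γ ℓ₀ : Submodule K V} (hΓ : Γ = span K (Set.range fun i : Fin m => (⇑φ)^[(i : ℕ)] P))
    (hΓℓ₀ : Disjoint Γ ℓ₀) {v₁ v₂ : V} (hv₁ : v₁ ≠ 0) (hv₂ : v₂ ≠ 0)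
    (hv₁P : v₁ ∈ (Γ ⊔ span K {(⇑φ)^[m] P}) ⊓ ℓ₀)
    (hv₂P : v₂ ∈ (Γ ⊔ span K {(⇑φ)^[m + 1] P}) ⊓ ℓ₀)
    (hL : project Γ ℓ₀ (pointsOf K W) =
      {Y | ∃ μ : K, μ ≠ 0 ∧ Y.submodule = span K {μ • v₁ + τ μ • v₂}}) :
    LinearIndependent K ![v₁, v₂] ∧ ∃ (u : K →ₗ[F] V) (p : Fin (m + 2) → V),
      Function.Injective u ∧ u.range = W ∧
      (∀ μ, (Γ ⊔ span K {u μ}) ⊓ ℓ₀ = span K {μ • v₁ + τ μ • v₂}) ∧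
      (∀ i, ∃ c : K, c ≠ 0 ∧ p i = c • (⇑φ)^[(i : ℕ)] P) ∧
      ∀ μ, u μ = ∑ i : Fin (m + 2), (τ ^ ((i : ℕ) + 2)) μ • p i := by
  have hli : LinearIndependent K fun i : Fin (m + 2) => (⇑φ)^[(i : ℕ)] P :=
    linearIndependent_of_top_le_span_of_card_eq_finrank hP.ge (by simp [hV])
  have hrange := range_orbitMap φ hK hV hW hτ hφ hli hP
  set w := orbitMap φ P (m + 2) with hw
  have hinj : Function.Injective w := by
    rw [← LinearMap.ker_eq_bot]
    apply Submodule.finrank_eq_zero.1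
    have := LinearMap.finrank_range_add_finrank_ker w
    rw [hrange, hW.1, hV, hK] at this
    omega
  obtain ⟨hv₁Γ, hv₁ℓ⟩ := hv₁P
  obtain ⟨hv₂Γ, hv₂ℓ⟩ := hv₂P
  obtain ⟨γ₁, hγ₁, z₁, hz₁, hv₁def⟩ := mem_sup.1 hv₁Γ
  obtain ⟨γ₂, hγ₂, z₂, hz₂, hv₂def⟩ := mem_sup.1 hv₂Γ
  obtain ⟨c₁, rfl⟩ := mem_span_singleton.1 hz₁
  obtain ⟨c₂, rfl⟩ := mem_span_singleton.1 hz₂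
  replace hv₁def := hv₁def.symm
  replace hv₂def := hv₂def.symm
  have hc₁ : c₁ ≠ 0 := by
    rintro rfl
    apply hv₁
    apply disjoint_def.1 hΓℓ₀ _ _ hv₁ℓ
    rw [hv₁def, zero_smul, add_zero]
    exact hγ₁
  have hc₂ : c₂ ≠ 0 := by
    rintro rfl
    apply hv₂
    apply disjoint_def.1 hΓℓ₀ _ _ hv₂ℓ
    rw [hv₂def, zero_smul, add_zero]
    exact hγ₂
  have hmod : ∀ x y : K, x • (⇑φ)^[m] P + y • (⇑φ)^[m + 1] P ∈ Γ → x = 0 ∧ y = 0 := by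
    intro x y hxy
    rw [hΓ] at hxy
    obtain ⟨g, hg⟩ := (Submodule.mem_span_range_iff_exists_fun K).1 hxy
    have hlast : ∀ i : Fin (m + 2), (Fin.snoc (α := fun _ => K) (Fin.snoc (α := fun _ => K) g (-x))
        (-y) : Fin (m + 2) → K) i = 0 := by
      apply Fintype.linearIndependent_iff.1 hli
      rw [Fin.sum_univ_castSucc, Fin.sum_univ_castSucc]
      simp only [Fin.snoc_castSucc, Fin.snoc_last, Fin.val_castSucc, Fin.val_last]
      rw [hg]
      simp only [neg_smul]
      abel
    constructor
    · simpa using hlast (Fin.last m).castSucc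
    · simpa using hlast (Fin.last (m + 1))
  have hv : LinearIndependent K ![v₁, v₂] := by
    rw [LinearIndependent.pair_iff]
    intro x y hxy
    have := hmod (x * c₁) (y * c₂) (by
      have h1 : (x * c₁) • (⇑φ)^[m] P + (y * c₂) • (⇑φ)^[m + 1] P = -(x • γ₁ + y • γ₂) := by
        rw [eq_neg_iff_add_eq_zero, ← hxy, hv₁def, hv₂def]
        module
      rw [h1]
      exact neg_mem (add_mem (smul_mem _ _ hγ₁) (smul_mem _ _ hγ₂)))
    simpa [hc₁, hc₂] using this
  -- Only the last two terms of the orbit sum survive modulo `Γ`, and there they are multiples of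
  -- `v₁` and `v₂`.
  have hproj : ∀ x : K, (Γ ⊔ span K {w x}) ⊓ ℓ₀ =
      span K {((τ ^ m) x * c₁⁻¹) • v₁ + ((τ ^ (m + 1)) x * c₂⁻¹) • v₂} := by
    intro x
    apply sup_span_inf_eq hΓℓ₀
    · exact add_mem (smul_mem _ _ hv₁ℓ) (smul_mem _ _ hv₂ℓ)
    · have h1 : w x - (((τ ^ m) x * c₁⁻¹) • v₁ + ((τ ^ (m + 1)) x * c₂⁻¹) • v₂) =
          ∑ i ∈ Finset.range m, (τ ^ i) x • (⇑φ)^[i] P -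
            (((τ ^ m) x * c₁⁻¹) • γ₁ + ((τ ^ (m + 1)) x * c₂⁻¹) • γ₂) := by
        rw [hw, orbitMap_apply, Finset.sum_range_succ, Finset.sum_range_succ, hv₁def, hv₂def,
          smul_add, smul_add, smul_smul, smul_smul, inv_mul_cancel_right₀ hc₁,
          inv_mul_cancel_right₀ hc₂]
        abel
      rw [h1]
      refine sub_mem (sum_mem fun i hi => smul_mem _ _ ?_)
        (add_mem (smul_mem _ _ hγ₁) (smul_mem _ _ hγ₂))
      rw [hΓ]
      exact subset_span ⟨⟨i, Finset.mem_range.1 hi⟩, rfl⟩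
  -- The two base points leave the ratio of `c₁` and `c₂` free. It is determined by `hL`, applied to
  -- the image of the single point `⟨w 1⟩`.
  obtain ⟨ρ, d, hρ, hd, hd₁, hd₂⟩ : ∃ ρ d : K, ρ ≠ 0 ∧ d ≠ 0 ∧ c₁⁻¹ = d * ρ ∧ c₂⁻¹ = d * τ ρ := by
    have hw1 : w 1 ≠ 0 := (map_ne_zero_iff w hinj).2 one_ne_zero
    have h1 := hproj 1
    simp only [map_one, one_mul] at h1
    have hy : c₁⁻¹ • v₁ + c₂⁻¹ • v₂ ≠ 0 := fun h0 =>
      inv_ne_zero hc₁ ((LinearIndependent.pair_iff.1 hv _ _ h0).1)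
    have hY : Projectivization.mk K _ hy ∈ project Γ ℓ₀ (pointsOf K W) := by
      refine ⟨Projectivization.mk K _ hw1, ⟨w 1, ?_, hw1, Projectivization.submodule_mk _ _⟩, ?_⟩
      · rw [← hrange]
        exact ⟨1, rfl⟩
      · rw [Projectivization.submodule_mk, Projectivization.submodule_mk, h1]
    rw [hL] at hY
    obtain ⟨ρ, hρ, h2⟩ := hY
    rw [Projectivization.submodule_mk, span_singleton_eq_iff] at h2
    obtain ⟨d, hd, h2⟩ := h2
    have h3 := LinearIndependent.pair_iff.1 hv (c₁⁻¹ - d * ρ) (c₂⁻¹ - d * τ ρ) (by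
      rw [sub_smul, sub_smul, mul_smul, mul_smul]
      rw [smul_add] at h2
      rw [sub_add_sub_comm, h2, sub_self])
    exact ⟨ρ, d, hρ, hd, sub_eq_zero.1 h3.1, sub_eq_zero.1 h3.2⟩
  have hτm : ∀ x, (τ ^ m) ((τ ^ 2) x) = x := by
    intro x
    rw [← AlgEquiv.mul_apply, ← pow_add, hτ]
    rfl
  have hτm1 : ∀ x, (τ ^ (m + 1)) ((τ ^ 2) x) = τ x := by
    intro x
    rw [pow_succ', AlgEquiv.mul_apply, hτm]
  -- The projection reads the coordinates `τᵐ` and `τᵐ⁺¹`. Precomposing with `τ²` turns these into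
  -- `1` and `τ`, since `τᵐ⁺² = 1`; the factor `ρ⁻¹` absorbs the scalars.
  refine ⟨hv, w ∘ₗ (τ ^ 2).toLinearMap ∘ₗ LinearMap.mulLeft F ρ⁻¹,
    fun i => ((τ ^ ((i : ℕ) + 2)) ρ)⁻¹ • (⇑φ)^[(i : ℕ)] P, ?_, ?_, ?_, ?_, ?_⟩
  · intro x y hxy
    exact mul_right_injective₀ (inv_ne_zero hρ) ((τ ^ 2).injective (hinj hxy))
  · rw [← hrange]
    apply LinearMap.range_comp_of_range_eq_top
    rw [LinearMap.range_eq_top]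
    intro x
    refine ⟨ρ * (τ ^ 2).symm x, ?_⟩
    rw [LinearMap.comp_apply, LinearMap.mulLeft_apply, inv_mul_cancel_left₀ hρ]
    exact (τ ^ 2).apply_symm_apply x
  · intro μ
    simp only [LinearMap.comp_apply, LinearMap.mulLeft_apply, AlgEquiv.toLinearMap_apply]
    rw [hproj, hτm, hτm1, span_singleton_eq_iff]
    refine ⟨d, hd, ?_⟩
    rw [smul_add, smul_smul, smul_smul, hd₁, hd₂, map_mul, map_inv₀]
    have hτρ : τ ρ ≠ 0 := (map_ne_zero τ).2 hρ
    congr 2 <;> field_simp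
  · intro i
    exact ⟨_, inv_ne_zero ((map_ne_zero _).2 hρ), rfl⟩
  · intro μ
    simp only [LinearMap.comp_apply, LinearMap.mulLeft_apply, AlgEquiv.toLinearMap_apply, hw,
      orbitMap_apply]
    rw [Finset.sum_range]
    refine Finset.sum_congr rfl fun i _ => ?_
    rw [smul_smul, pow_add, AlgEquiv.mul_apply, AlgEquiv.mul_apply, map_mul, map_mul, map_inv₀,
      map_inv₀, mul_comm]

end Subgeometry

/-! ### The curve and the subline attached to a line of the family. -/

section Curves

variable {F K V : Type*} [Field F] [Field K] [Algebra F K] [AddCommGroup V] [Module F V]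
  [Module K V] [IsScalarTower F K V]

omit [IsScalarTower F K V] in
lemma mem_pointsOf_iff_of_range_eq {W : Submodule F V} {u : K →ₗ[F] V}
    (hinj : Function.Injective u) (hu : u.range = W)
    {X : Projectivization K V} :
    X ∈ pointsOf K W ↔ ∃ μ : K, μ ≠ 0 ∧ X.submodule = span K {u μ} := by
  subst hu
  constructor
  · rintro ⟨_, ⟨μ, rfl⟩, h0, h⟩
    exact ⟨μ, fun h => h0 (by rw [h, map_zero]), h⟩
  · rintro ⟨μ, h0, h⟩
    exact ⟨u μ, ⟨μ, rfl⟩, (map_ne_zero_iff u hinj).2 h0, h⟩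

omit [Algebra F K] [Module F V] [IsScalarTower F K V] [Field F] in
lemma span_pair_eq_iff {v₁ v₂ : V} (hv : LinearIndependent K ![v₁, v₂]) {a b c d : K}
    (ha : a ≠ 0) (hcd : ¬ (c = 0 ∧ d = 0)) :
    span K {a • v₁ + b • v₂} = span K {c • v₁ + d • v₂} ↔ a * d = b * c := by
  rw [span_singleton_eq_iff]
  constructor
  · rintro ⟨k, -, h⟩
    have := LinearIndependent.pair_iff.1 hv (a - k * c) (b - k * d) (by
      rw [sub_smul, sub_smul, sub_add_sub_comm, h]
      module)
    linear_combination d * this.1 - c * this.2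
  · intro h
    have hc : c ≠ 0 := by
      rintro rfl
      refine hcd ⟨rfl, ?_⟩
      simpa [ha] using h
    refine ⟨a / c, div_ne_zero ha hc, ?_⟩
    rw [smul_add, smul_smul, smul_smul, div_mul_cancel₀ _ hc, div_mul_eq_mul_div, h,
      mul_div_cancel_right₀ _ hc]

section LineImage

variable {W : Submodule F V} {u : K →ₗ[F] V} {Γ ℓ₀ : Submodule K V} {v₁ v₂ : V}
  {τ : Gal(K/F)}

-- With `μ ≠ 0`, equality of two points of `ℓ₀` is one cross-multiplied equation in their
-- coordinates.
omit [IsScalarTower F K V] in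
lemma mem_curveOf_iff (hinj : Function.Injective u) (hu : u.range = W)
    (hv : LinearIndependent K ![v₁, v₂])
    (hproj : ∀ μ, (Γ ⊔ span K {u μ}) ⊓ ℓ₀ = span K {μ • v₁ + τ μ • v₂})
    {f : Submodule F (K × K)} {X : Projectivization K V} :
    X ∈ curveOf W Γ ℓ₀ v₁ v₂ f ↔ ∃ μ : K, μ ≠ 0 ∧ X.submodule = span K {u μ} ∧
      ∃ p ∈ f, p ≠ 0 ∧ μ * p.2 = τ μ * p.1 := by
  have hp0 : ∀ p : K × K, p ≠ 0 → ¬ (p.1 = 0 ∧ p.2 = 0) := fun p hp h =>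
    hp (Prod.ext h.1 h.2)
  constructor
  · rintro ⟨hX, Y, ⟨p, hpf, hp, hYp⟩, hY⟩
    obtain ⟨μ, hμ, hX⟩ := (mem_pointsOf_iff_of_range_eq hinj hu).1 hX
    refine ⟨μ, hμ, hX, p, hpf, hp, ?_⟩
    rw [hX, hproj, hYp] at hY
    exact (span_pair_eq_iff hv hμ (hp0 p hp)).1 hY.symm
  · rintro ⟨μ, hμ, hX, p, hpf, hp, h⟩
    refine ⟨(mem_pointsOf_iff_of_range_eq hinj hu).2 ⟨μ, hμ, hX⟩, ?_⟩
    have hne : p.1 • v₁ + p.2 • v₂ ≠ 0 := fun h0 =>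
      hp0 p hp (LinearIndependent.pair_iff.1 hv _ _ h0)
    refine ⟨Projectivization.mk K _ hne, ⟨p, hpf, hp, Projectivization.submodule_mk _ _⟩, ?_⟩
    rw [Projectivization.submodule_mk, hX, hproj]
    exact ((span_pair_eq_iff hv hμ (hp0 p hp)).2 h).symm

/-- The coordinates of a line `{(κ⁻¹ y, κ⁻¹ τⁿ(y))}`, `y ∈ ⟨a, b⟩`. -/
def IsLineParam (τ : Gal(K/F)) (n : ℕ) (κ a b : K) (f : Submodule F (K × K)) : Prop :=
  κ ≠ 0 ∧ LinearIndependent F ![a, b] ∧ ∀ p : K × K, p ∈ f ↔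
    ∃ s r : F, p = (κ⁻¹ * (s • a + r • b), κ⁻¹ * (τ ^ n) (s • a + r • b))

/-- Hilbert 90 for `τⁿ` gives `k = τⁿ(κ)/κ`, so `(z, k τⁿ(z)) = κ⁻¹ (y, τⁿ(y))` with `y = κ z`. The
common factor `κ⁻¹` does not change points of `ℓ₀`. -/
lemma exists_isLineParam [Fintype F] [FiniteDimensional F K] [IsGalois F K]
    (hp : (Module.finrank F K).Prime) {n h : ℕ} (hn : τ ^ n ≠ 1)
    (hτn : ∀ x, (τ ^ n) x = x ^ (Fintype.card F ^ h)) {f : Submodule F (K × K)}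
    (hf : IsLineInFamily h f) : ∃ κ a b, IsLineParam τ n κ a b f := by
  obtain ⟨hf2, k, hk, hfk⟩ := hf
  obtain ⟨κ, hκ, hkκ⟩ := exists_eq_div_of_norm_eq_one hp hn hk
  have hmem : ∀ p ∈ f, p.2 = k * (τ ^ n) p.1 := fun p hpf => by
    rw [hτn]
    exact hfk hpf
  have : FiniteDimensional F f := FiniteDimensional.of_finrank_pos (by omega)
  let bs := Module.finBasisOfFinrankEq F f hf2
  have hrep : ∀ p : K × K, p ∈ f ↔ ∃ s r : F, p = s • (bs 0 : K × K) + r • (bs 1 : K × K) := by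
    intro p
    constructor
    · intro hpf
      have := bs.sum_repr ⟨p, hpf⟩
      rw [Fin.sum_univ_two] at this
      exact ⟨_, _, (congrArg Subtype.val this).symm⟩
    · rintro ⟨s, r, rfl⟩
      exact add_mem (smul_mem _ _ (bs 0).2) (smul_mem _ _ (bs 1).2)
  have hy : ∀ p ∈ f, κ * p.2 = (τ ^ n) (κ * p.1) := fun p hpf => by
    rw [hmem p hpf, map_mul, ← hkκ]
    ring
  refine ⟨κ, κ * (bs 0 : K × K).1, κ * (bs 1 : K × K).1, hκ, ?_, fun p => ?_⟩
  · rw [LinearIndependent.pair_iff]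
    intro s r h0
    have h1 : s • (bs 0 : K × K).1 + r • (bs 1 : K × K).1 = 0 := by
      rw [← mul_smul_comm, ← mul_smul_comm, ← mul_add] at h0
      exact (mul_eq_zero.1 h0).resolve_left hκ
    have h2 : s • bs 0 + r • bs 1 = 0 := by
      apply Subtype.ext
      have hmem1 : s • (bs 0 : K × K) + r • (bs 1 : K × K) ∈ f := (hrep _).2 ⟨s, r, rfl⟩
      have h3 := hmem _ hmem1
      apply Prod.ext
      · exact h1
      · change (s • (bs 0 : K × K) + r • (bs 1 : K × K)).2 = 0
        rw [h3]
        change k * (τ ^ n) (s • (bs 0 : K × K).1 + r • (bs 1 : K × K).1) = 0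
        rw [h1, map_zero, mul_zero]
    have hli := bs.linearIndependent
    rw [Fintype.linearIndependent_iff] at hli
    have := hli ![s, r] (by simpa [Fin.sum_univ_two] using h2)
    exact ⟨this 0, this 1⟩
  · have hcomb : ∀ s r : F, s • (κ * (bs 0 : K × K).1) + r • (κ * (bs 1 : K × K).1) =
        κ * (s • (bs 0 : K × K) + r • (bs 1 : K × K)).1 := by
      intro s r
      rw [← mul_smul_comm, ← mul_smul_comm, ← mul_add]
      rfl
    have hcoord : ∀ p ∈ f, p = (κ⁻¹ * (κ * p.1), κ⁻¹ * (τ ^ n) (κ * p.1)) := by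
      intro p hpf
      rw [← hy p hpf, inv_mul_cancel_left₀ hκ, inv_mul_cancel_left₀ hκ]
    rw [hrep]
    constructor
    · rintro ⟨s, r, rfl⟩
      refine ⟨s, r, ?_⟩
      rw [hcomb]
      exact hcoord _ ((hrep _).2 ⟨s, r, rfl⟩)
    · rintro ⟨s, r, rfl⟩
      refine ⟨s, r, ?_⟩
      rw [hcomb]
      exact (hcoord _ ((hrep _).2 ⟨s, r, rfl⟩)).symm

lemma IsLineParam.comb_ne_zero {n : ℕ} {κ a b : K} {f : Submodule F (K × K)}
    (hf : IsLineParam τ n κ a b f) {s r : F} (hsr : ¬ (s = 0 ∧ r = 0)) : s • a + r • b ≠ 0 :=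
  fun h => hsr (LinearIndependent.pair_iff.1 hf.2.1 _ _ h)

lemma param_comp_linearMap {n : ℕ} (u : K →ₗ[F] V) (g : Fin (n + 1) → K) (s r : F) :
    param (u ∘ g) (algebraMap F K s) (algebraMap F K r) =
      u (param g (algebraMap F K s) (algebraMap F K r)) := by
  rw [param, param, map_sum]
  refine Finset.sum_congr rfl fun j _ => ?_
  rw [← map_pow, ← map_pow, ← map_mul, algebraMap_smul, algebraMap_smul, map_smul]
  rfl

/-- The vectors defining the curve that corresponds to the line `⟨a, b⟩`. -/
noncomputable def curveVectors (u : K →ₗ[F] V) (τ : Gal(K/F)) (a b : K) (n : ℕ) :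
    Fin (n + 1) → V :=
  u ∘ fun k : Fin (n + 1) => (orbitPoly τ a b n).coeff k

lemma param_curveVectors (u : K →ₗ[F] V) (a b : K) (n : ℕ) (s r : F) :
    param (curveVectors u τ a b n) (algebraMap F K s) (algebraMap F K r) =
      u (∏ i ∈ Finset.range n, (τ ^ i) (s • a + r • b)) := by
  rw [curveVectors, param_comp_linearMap, param_orbitPoly]
  congr 1
  refine Finset.prod_congr rfl fun i _ => ?_
  rw [map_add, map_smul, map_smul, Algebra.smul_def, Algebra.smul_def]

/-- The equation `τ(μ)/μ = τⁿ(y)/y` is solved by the `F`-multiples of the product of the `τⁱ(y)`, `i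
< n`. With `y = s a + r b` this is the form with coefficients `orbitPoly`, carried to `V` by `u`. -/
theorem curveOf_eq_curvePoints [FiniteDimensional F K] [IsGalois F K]
    (hp : (Module.finrank F K).Prime) (hτ : τ ≠ 1)
    (hinj : Function.Injective u) (hu : u.range = W)
    (hv : LinearIndependent K ![v₁, v₂])
    (hproj : ∀ μ, (Γ ⊔ span K {u μ}) ⊓ ℓ₀ = span K {μ • v₁ + τ μ • v₂})
    {f : Submodule F (K × K)} {n : ℕ} {κ a b : K} (hf : IsLineParam τ n κ a b f) :
    curveOf W Γ ℓ₀ v₁ v₂ f = curvePoints F (curveVectors u τ a b n) := by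
  ext X
  rw [mem_curveOf_iff hinj hu hv hproj, mem_curvePoints]
  have hκ := inv_ne_zero hf.1
  constructor
  · rintro ⟨μ, hμ, hX, p, hpf, hp0, h⟩
    obtain ⟨s, r, rfl⟩ := (hf.2.2 p).1 hpf
    have hsr : ¬ (s = 0 ∧ r = 0) := by
      rintro ⟨rfl, rfl⟩
      apply hp0
      simp
    refine ⟨s, r, hsr, ?_⟩
    have h' : μ * (τ ^ n) (s • a + r • b) = τ μ * (s • a + r • b) := by
      apply mul_left_cancel₀ hκ
      linear_combination h
    obtain ⟨c, rfl⟩ := (map_mul_eq_iff_prod_orbit hp hτ (hf.comb_ne_zero hsr) n).1 h'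
    rw [hX, param_curveVectors, span_singleton_eq_iff]
    refine ⟨algebraMap F K c, fun h0 => hμ (by rw [h0, zero_mul]), ?_⟩
    rw [← Algebra.smul_def, map_smul, algebraMap_smul]
  · rintro ⟨s, r, hsr, hX⟩
    rw [param_curveVectors] at hX
    have hy := hf.comb_ne_zero hsr
    refine ⟨_, Finset.prod_ne_zero_iff.2 fun i _ => (map_ne_zero (τ ^ i)).2 hy, hX, _,
      (hf.2.2 _).2 ⟨s, r, rfl⟩, fun h0 => mul_ne_zero hκ hy (congrArg Prod.fst h0), ?_⟩
    have := (map_mul_eq_iff_prod_orbit hp hτ hy n).2 ⟨1, by rw [map_one, one_mul]⟩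
    linear_combination κ⁻¹ * this

omit [IsScalarTower F K V] in
lemma project_curveOf_eq [FiniteDimensional F K] [IsGalois F K]
    (hp : (Module.finrank F K).Prime) (hτ : τ ≠ 1)
    (hinj : Function.Injective u) (hu : u.range = W)
    (hv : LinearIndependent K ![v₁, v₂])
    (hproj : ∀ μ, (Γ ⊔ span K {u μ}) ⊓ ℓ₀ = span K {μ • v₁ + τ μ • v₂})
    {f : Submodule F (K × K)} {n : ℕ} {κ a b : K} (hf : IsLineParam τ n κ a b f) :
    project Γ ℓ₀ (curveOf W Γ ℓ₀ v₁ v₂ f) = B v₁ v₂ f := by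
  have hκ := inv_ne_zero hf.1
  ext Y
  constructor
  · rintro ⟨X, ⟨-, Y', hY', hX'⟩, hX⟩
    rwa [Projectivization.submodule_injective (hX.trans hX'.symm)]
  · rintro ⟨p, hpf, hp0, hY⟩
    obtain ⟨s, r, rfl⟩ := (hf.2.2 p).1 hpf
    have hy : s • a + r • b ≠ 0 := by
      intro h0
      apply hp0
      rw [h0]
      simp
    have hM : ∏ i ∈ Finset.range n, (τ ^ i) (s • a + r • b) ≠ 0 :=
      Finset.prod_ne_zero_iff.2 fun i _ => (map_ne_zero (τ ^ i)).2 hy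
    have hX : u (∏ i ∈ Finset.range n, (τ ^ i) (s • a + r • b)) ≠ 0 :=
      (map_ne_zero_iff u hinj).2 hM
    have key := (map_mul_eq_iff_prod_orbit hp hτ hy n).2 ⟨1, by rw [map_one, one_mul]⟩
    refine ⟨Projectivization.mk K _ hX, (mem_curveOf_iff hinj hu hv hproj).2
      ⟨_, hM, Projectivization.submodule_mk _ _, _, hpf, hp0, ?_⟩, ?_⟩
    · linear_combination κ⁻¹ * key
    · rw [hY, Projectivization.submodule_mk, hproj]
      refine ((span_pair_eq_iff hv hM
        fun h => mul_ne_zero hκ hy h.1).2 ?_).symm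
      linear_combination κ⁻¹ * key

lemma isSubline_B [FiniteDimensional F K] [IsGalois F K] [FiniteDimensional K V]
    (hp : (Module.finrank F K).Prime) (hv : LinearIndependent K ![v₁, v₂])
    {f : Submodule F (K × K)} {n : ℕ} (hn : τ ^ n ≠ 1) {κ a b : K}
    (hf : IsLineParam τ n κ a b f) (hf2 : Module.finrank F f = 2) :
    IsSubline F (B v₁ v₂ f : Set (Projectivization K V)) := by
  let L : K × K →ₗ[F] V :=
    (LinearMap.toSpanSingleton K V v₁).restrictScalars F ∘ₗ LinearMap.fst F K K +
      (LinearMap.toSpanSingleton K V v₂).restrictScalars F ∘ₗ LinearMap.snd F K K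
  have hL : ∀ p, L p = p.1 • v₁ + p.2 • v₂ := fun p => rfl
  have hLinj : Function.Injective L := by
    rw [← LinearMap.ker_eq_bot, LinearMap.ker_eq_bot']
    intro p hp0
    rw [hL] at hp0
    have := LinearIndependent.pair_iff.1 hv _ _ hp0
    exact Prod.ext this.1 this.2
  refine ⟨f.map L, ?_, ?_, ?_⟩
  · rw [← hf2]
    exact (LinearEquiv.finrank_eq (Submodule.equivMapOfInjective L hLinj f)).symm
  · apply le_antisymm
    · have h1 : span K ((f.map L : Submodule F V) : Set V) ≤ span K (Set.range ![v₁, v₂]) := by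
        rw [span_le]
        rintro _ ⟨p, -, rfl⟩
        rw [hL]
        exact add_mem (smul_mem _ _ (subset_span ⟨0, rfl⟩)) (smul_mem _ _ (subset_span ⟨1, rfl⟩))
      refine (Submodule.finrank_mono h1).trans ?_
      rw [finrank_span_eq_card hv, Fintype.card_fin]
    -- The images of two generators of `f` are independent even over `K`, by the Moore determinant
    -- for `τⁿ`.
    · have hdet := mul_map_sub_mul_map_ne_zero hp hn hf.2.1
      have hκ := inv_ne_zero hf.1
      have hli : LinearIndependent K
          ![L (κ⁻¹ * a, κ⁻¹ * (τ ^ n) a), L (κ⁻¹ * b, κ⁻¹ * (τ ^ n) b)] := by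
        rw [LinearIndependent.pair_iff]
        intro x y hxy
        rw [hL, hL] at hxy
        have h2 := LinearIndependent.pair_iff.1 hv (x * (κ⁻¹ * a) + y * (κ⁻¹ * b))
          (x * (κ⁻¹ * (τ ^ n) a) + y * (κ⁻¹ * (τ ^ n) b)) (by
            rw [← hxy]
            module)
        have hx : x * (κ⁻¹ * (a * (τ ^ n) b - b * (τ ^ n) a)) = 0 := by
          linear_combination (τ ^ n) b * h2.1 - b * h2.2
        have hy : y * (κ⁻¹ * (a * (τ ^ n) b - b * (τ ^ n) a)) = 0 := by
          linear_combination a * h2.2 - (τ ^ n) a * h2.1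
        exact ⟨(mul_eq_zero.1 hx).resolve_right (mul_ne_zero hκ hdet),
          (mul_eq_zero.1 hy).resolve_right (mul_ne_zero hκ hdet)⟩
      have h1 : span K (Set.range
          ![L (κ⁻¹ * a, κ⁻¹ * (τ ^ n) a), L (κ⁻¹ * b, κ⁻¹ * (τ ^ n) b)]) ≤
          span K ((f.map L : Submodule F V) : Set V) := by
        apply span_mono
        rintro _ ⟨i, rfl⟩
        fin_cases i
        · exact ⟨_, (hf.2.2 _).2 ⟨1, 0, by simp⟩, rfl⟩
        · exact ⟨_, (hf.2.2 _).2 ⟨0, 1, by simp⟩, rfl⟩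
      have := Submodule.finrank_mono h1
      rwa [finrank_span_eq_card hli, Fintype.card_fin] at this
  · ext Y
    constructor
    · rintro ⟨p, hpf, hp0, hY⟩
      exact ⟨L p, ⟨p, hpf, rfl⟩, (map_ne_zero_iff L hLinj).2 hp0, hY⟩
    · rintro ⟨_, ⟨p, hpf, rfl⟩, hp0, hY⟩
      exact ⟨p, hpf, fun h => hp0 (by rw [h, map_zero]), hY⟩

end LineImage

end Curves

/-! ### Extension of the curves to `K`: rational points, uniqueness, and imaginary points. -/

section RationalCurves

variable {F K V : Type*} [Field F] [Field K] [Algebra F K] [AddCommGroup V] [Module F V]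
  [Module K V] [IsScalarTower F K V]

omit [Module F V] [IsScalarTower F K V] in
lemma curvePoints_subset_curvePoints {n : ℕ} (e : Fin (n + 1) → V) :
    (curvePoints F e : Set (Projectivization K V)) ⊆ curvePoints K e := by
  rintro X (⟨y, hy⟩ | h)
  · exact Or.inl ⟨algebraMap F K y, hy⟩
  · exact Or.inr h

lemma param_algebraMap_mem {n : ℕ} {W : Submodule F V} {e : Fin (n + 1) → V}
    (heW : ∀ j, e j ∈ W) (s r : F) :
    param e (algebraMap F K s) (algebraMap F K r) ∈ W := by
  refine sum_mem fun j _ => ?_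
  rw [← map_pow, ← map_pow, ← map_mul, algebraMap_smul]
  exact smul_mem _ _ (heW j)

/-- The points of the subgeometry on a rational curve that spans it. -/
lemma curvePoints_inter_pointsOf {m : ℕ} {W : Submodule F V} (hW : Module.finrank F W = m + 2)
    {e : Fin (m + 1 + 1) → V} (he : LinearIndependent K e) (heW : ∀ j, e j ∈ W) :
    (curvePoints K e ∩ pointsOf K W : Set (Projectivization K V)) = curvePoints F e := by
  ext X
  constructor
  · rintro ⟨hX, w, hw, hw0, hXw⟩
    rw [mem_curvePoints] at hX
    obtain ⟨s, r, hsr, hX⟩ := hX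
    simp only [Algebra.algebraMap_self, RingHom.id_apply] at hX
    obtain ⟨c, hc, h⟩ := span_singleton_eq_iff.1 (hX.symm.trans hXw)
    have heF : LinearIndependent F e := he.restrict_scalars' F
    let e' : Fin (m + 1 + 1) → W := fun j => ⟨e j, heW j⟩
    have he' : LinearIndependent F e' := LinearIndependent.of_comp W.subtype heF
    have htop := he'.span_eq_top_of_card_eq_finrank (by rw [hW, Fintype.card_fin])
    have hwmem : (⟨w, hw⟩ : W) ∈ span F (Set.range e') := by rw [htop]; trivial
    obtain ⟨β, hβ⟩ := (Submodule.mem_span_range_iff_exists_fun F).1 hwmem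
    have hβ' : ∑ j, β j • e j = w := by
      have := congrArg W.subtype hβ
      rw [map_sum] at this
      exact this
    have hco : ∀ j : Fin (m + 1 + 1), s ^ (j.rev : ℕ) * r ^ (j : ℕ) = c * algebraMap F K (β j) := by
      intro j
      refine sub_eq_zero.1 (Fintype.linearIndependent_iff.1 he
        (fun j => s ^ (j.rev : ℕ) * r ^ (j : ℕ) - c * algebraMap F K (β j)) ?_ j)
      simp only [sub_smul, Finset.sum_sub_distrib, mul_smul, algebraMap_smul]
      rw [← Finset.smul_sum, hβ', ← h, param]
      simp only [mul_smul, sub_self]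
    by_cases hs : s = 0
    · right
      have hr : r ≠ 0 := fun hr => hsr ⟨hs, hr⟩
      rw [hX, ← param_zero_one (K := K) e]
      exact span_param_eq_of_mul_eq e hsr (by simp) (by simp [hs])
    -- For `s ≠ 0` the first two coordinates `sᵐ⁺¹` and `sᵐ r` recover the ratio of `s` and `r`,
    -- which is therefore that of `β 0` and `β 1` in `F`.
    · have h0 := hco 0
      have h1 := hco 1
      simp only [Fin.val_rev, Fin.val_zero, Fin.val_one, pow_zero, mul_one, pow_one] at h0 h1
      have e0 : m + 1 + 1 - (0 + 1) = m + 1 := by omega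
      have e1 : m + 1 + 1 - (1 + 1) = m := by omega
      rw [e0] at h0
      rw [e1] at h1
      have hβ0 : algebraMap F K (β 0) ≠ 0 := by
        intro h2
        rw [h2, mul_zero] at h0
        exact hs (pow_eq_zero_iff (by omega)|>.1 h0)
      rw [mem_curvePoints]
      refine ⟨β 0, β 1, fun h2 => hβ0 (by rw [h2.1, map_zero]), ?_⟩
      rw [hX]
      refine span_param_eq_of_mul_eq e hsr (fun h2 => hβ0 h2.1) ?_
      apply mul_left_cancel₀ (mul_ne_zero hc (pow_ne_zero m hs))
      linear_combination (-s ^ (m + 1)) * h1 + s ^ m * r * h0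
  · intro hX
    refine ⟨curvePoints_subset_curvePoints e hX, ?_⟩
    obtain ⟨s, r, hsr, hX⟩ := mem_curvePoints.1 hX
    refine ⟨_, param_algebraMap_mem heW s r, param_ne_zero he ?_, hX⟩
    simpa using hsr

omit [Module F V] [IsScalarTower F K V] in
/-- A curve is determined by its `F`-rational points if there are enough of them. -/
lemma curvePoints_eq_of_subset [Fintype F] {m : ℕ} (hq : m + 2 < Fintype.card F)
    {e e' : Fin (m + 1 + 1) → V} (he : LinearIndependent K e) (he' : LinearIndependent K e')
    (h : (curvePoints F e : Set (Projectivization K V)) ⊆ curvePoints K e') :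
    (curvePoints K e : Set (Projectivization K V)) = curvePoints K e' := by
  have hs : ∀ o : Option F, ¬ ((o.elim 0 fun _ => (1 : F)) = 0 ∧ (o.elim 1 fun y => y) = 0) := by
    rintro (_ | y) <;> simp
  have hs' : ∀ o : Option F, ¬ (algebraMap F K (o.elim 0 fun _ => (1 : F)) = 0 ∧
      algebraMap F K (o.elim 1 fun y => y) = 0) := fun o => by simpa using hs o
  -- The `q + 1` points over `F`, with `none` standing for the parameter `(0, 1)`.
  let X : Option F → Projectivization K V := fun o =>
    Projectivization.mk K (param e (algebraMap F K (o.elim 0 fun _ => (1 : F)))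
      (algebraMap F K (o.elim 1 fun y => y))) (param_ne_zero he (hs' o))
  have hXmem : ∀ o, X o ∈ (curvePoints F e : Set (Projectivization K V)) := fun o =>
    mem_curvePoints.2 ⟨_, _, hs o, Projectivization.submodule_mk _ _⟩
  have hXinj : Function.Injective X := by
    intro o o' ho
    have h1 := congrArg Projectivization.submodule ho
    simp only [X, Projectivization.submodule_mk] at h1
    obtain ⟨c, hc, h2⟩ := span_singleton_eq_iff.1 h1
    have hco : ∀ (s r s' r' : K), param e s r = c • param e s' r' →
        s ^ (m + 1) = c * s' ^ (m + 1) ∧ s ^ m * r = c * (s' ^ m * r') := by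
      intro s r s' r' h3
      have h4 := Fintype.linearIndependent_iff.1 he
        (fun j => s ^ (j.rev : ℕ) * r ^ (j : ℕ) - c * (s' ^ (j.rev : ℕ) * r' ^ (j : ℕ))) (by
          simp only [sub_smul, Finset.sum_sub_distrib, mul_smul c]
          rw [← Finset.smul_sum]
          exact sub_eq_zero.2 h3)
      have h5 := sub_eq_zero.1 (h4 0)
      have h6 := sub_eq_zero.1 (h4 1)
      simp only [Fin.val_rev, Fin.val_zero, Fin.val_one, pow_zero, mul_one, pow_one] at h5 h6
      have e0 : m + 1 + 1 - (0 + 1) = m + 1 := by omega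
      have e1 : m + 1 + 1 - (1 + 1) = m := by omega
      rw [e0] at h5
      rw [e1] at h6
      exact ⟨h5, h6⟩
    have h3 := hco _ _ _ _ h2
    rcases o with _ | y <;> rcases o' with _ | y'
    · rfl
    · simp only [Option.elim, map_zero, map_one, ne_eq, Nat.add_eq_zero_iff, one_ne_zero, and_false,
        not_false_eq_true, zero_pow, one_pow, mul_one] at h3
      exact absurd h3.1.symm hc
    · simp at h3
    · simp only [Option.elim, map_one, one_pow, mul_one, one_mul] at h3
      rw [← h3.1, one_mul] at h3
      rw [(algebraMap F K).injective h3.2]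
  -- A curve of order `m + 1` needs `m + 4` common points; `q + 1` are available.
  obtain ⟨j⟩ : Nonempty (Option (Option (Fin (m + 1 + 1))) ↪ Option F) := by
    apply Function.Embedding.nonempty_of_card_le
    simp only [Fintype.card_option, Fintype.card_fin]
    omega
  have hinj := hXinj.comp j.injective
  apply Set.Subset.antisymm
  · exact curvePoints_subset_of_common_points he hinj
      (fun i => curvePoints_subset_curvePoints e (hXmem _)) (fun i => h (hXmem _))
  · exact curvePoints_subset_of_common_points he' hinj
      (fun i => h (hXmem _)) (fun i => curvePoints_subset_curvePoints e (hXmem _))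

variable {τ : Gal(K/F)}

omit [IsScalarTower F K V] in
/-- A rational curve that contains `⟨P⟩` contains the whole orbit of `⟨P⟩`. -/
lemma span_iterate_eq_span_param {φ : V →ₛₗ[(τ : K →+* K)] V} {W : Submodule F V}
    (hφ : ∀ w ∈ W, φ w = w) {n : ℕ} {e : Fin (n + 1) → V} (heW : ∀ j, e j ∈ W) {P : V} {s r : K}
    (h : span K {P} = span K {param e s r}) (i : ℕ) :
    span K {(⇑φ)^[i] P} = span K {param e ((τ ^ i) s) ((τ ^ i) r)} := by
  obtain ⟨c, hc, rfl⟩ := span_singleton_eq_iff.1 h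
  rw [span_singleton_eq_iff]
  refine ⟨(τ ^ i) c, (map_ne_zero _).2 hc, ?_⟩
  rw [iterate_semilinear_smul, param, iterate_semilinear_sum]
  congr 1
  refine Finset.sum_congr rfl fun j _ => ?_
  rw [iterate_semilinear_smul, map_mul, map_pow, map_pow,
    Function.iterate_fixed (hφ _ (heW j)) i]

omit [IsScalarTower F K V] in
/-- The curve of the line `⟨a, b⟩` of full order contains the imaginary point `⟨P⟩`. -/
lemma span_eq_span_param_curveVectors {m : ℕ} {u : K →ₗ[F] V} {p : Fin (m + 2) → V} {P : V}
    (hτ : τ ^ (m + 2) = 1) {c : K} (hc : c ≠ 0) (hp0 : p 0 = c • P)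
    (hu : ∀ μ, u μ = ∑ i : Fin (m + 2), (τ ^ ((i : ℕ) + 2)) μ • p i) {a b : K}
    (hne : param (curveVectors u τ a b (m + 1)) (-τ b) (τ a) ≠ 0) :
    span K {P} = span K {param (curveVectors u τ a b (m + 1)) (-τ b) (τ a)} := by
  have hco : ∀ s r : K, param (curveVectors u τ a b (m + 1)) s r =
      ∑ i : Fin (m + 2), param (fun k : Fin (m + 1 + 1) =>
        (τ ^ ((i : ℕ) + 2)) ((orbitPoly τ a b (m + 1)).coeff k)) s r • p i := by
    intro s r
    simp only [param, curveVectors, Function.comp_apply, hu, Finset.smul_sum, Finset.sum_smul]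
    rw [Finset.sum_comm]
    refine Finset.sum_congr rfl fun i _ => Finset.sum_congr rfl fun k _ => ?_
    rw [smul_smul, smul_eq_mul]
  -- The `i`-th coordinate is a product over the conjugates `τ^(i + 2 + j)` with `j ≤ m`. The
  -- exponent `1` modulo `m + 2` occurs at `j = m + 1 - i`, which is in range unless `i = 0`, and
  -- that factor vanishes at `(-τ b, τ a)`.
  have hzero : ∀ i : Fin (m + 2), i ≠ 0 → param (fun k : Fin (m + 1 + 1) =>
      (τ ^ ((i : ℕ) + 2)) ((orbitPoly τ a b (m + 1)).coeff k)) (-τ b) (τ a) = 0 := by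
    intro i hi
    have hi0 : (i : ℕ) ≠ 0 := fun h => hi (Fin.ext h)
    -- `-τ b` and `τ a` are images under `τ ^ (i + 2)`
    have hpow : ∀ x, (τ ^ ((i : ℕ) + 2)) ((τ ^ (m + 1 - (i : ℕ))) x) = τ x := by
      intro x
      rw [← AlgEquiv.mul_apply, ← pow_add,
        show (i : ℕ) + 2 + (m + 1 - (i : ℕ)) = (m + 2) + 1 by omega, pow_succ, hτ, one_mul]
    have h1 : param (fun k : Fin (m + 1 + 1) =>
        (τ ^ ((i : ℕ) + 2)) ((orbitPoly τ a b (m + 1)).coeff k)) (-τ b) (τ a) =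
        (τ ^ ((i : ℕ) + 2)) (param (fun k : Fin (m + 1 + 1) => (orbitPoly τ a b (m + 1)).coeff k)
          (-(τ ^ (m + 1 - (i : ℕ))) b) ((τ ^ (m + 1 - (i : ℕ))) a)) := by
      rw [param, param, map_sum]
      refine Finset.sum_congr rfl fun k _ => ?_
      rw [smul_eq_mul, smul_eq_mul, map_mul, map_mul, map_pow, map_pow, map_neg, hpow, hpow]
    rw [h1, param_orbitPoly, Finset.prod_eq_zero (i := m + 1 - (i : ℕ))]
    · rw [map_zero]
    · rw [Finset.mem_range]; omega
    · ring
  rw [hco, Finset.sum_eq_single 0 (fun i _ hi => by rw [hzero i hi, zero_smul]) (by simp)] at hne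
  rw [hco, Finset.sum_eq_single 0 (fun i _ hi => by rw [hzero i hi, zero_smul]) (by simp)]
  set d := param (fun k : Fin (m + 1 + 1) =>
      (τ ^ (((0 : Fin (m + 2)) : ℕ) + 2)) ((orbitPoly τ a b (m + 1)).coeff k)) (-τ b) (τ a)
  have hd : d ≠ 0 := fun h => hne (by rw [h, zero_smul])
  rw [eq_comm, span_singleton_eq_iff]
  exact ⟨d * c, mul_ne_zero hd hc, by rw [hp0, smul_smul]⟩

end RationalCurves

/-! ### Powers of Frobenius with exponents modulo the degree. -/

section Frobenius

variable {F K : Type*} [Field F] [Fintype F] [Field K] [Algebra F K] [Finite K]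

lemma frobenius_pow_apply (k : ℕ) (x : K) :
    ((FiniteField.frobeniusAlgEquivOfAlgebraic F K) ^ k) x = x ^ (Fintype.card F ^ k) := by
  induction k with
  | zero => simp
  | succ k ih =>
    rw [pow_succ', AlgEquiv.mul_apply, ih]
    simp [pow_succ, pow_mul]

lemma frobenius_pow_pow_apply_of_modEq {ν n h : ℕ} (hn : n * ν ≡ h [MOD Module.finrank F K])
    (x : K) :
    (((FiniteField.frobeniusAlgEquivOfAlgebraic F K) ^ ν) ^ n) x = x ^ (Fintype.card F ^ h) := by
  rw [← frobenius_pow_apply, ← pow_mul, mul_comm]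
  congr 1
  rw [pow_eq_pow_iff_modEq, FiniteField.orderOf_frobeniusAlgEquivOfAlgebraic]
  exact hn

end Frobenius

/-! ### Distinctness of points, and lines with prescribed parameters. -/

section Points

variable {F K V : Type*} [Field F] [Field K] [Algebra F K] [AddCommGroup V] [Module F V]
  [Module K V]

omit [Algebra F K] [Module F V] [Field F] in
lemma span_ne_span_of_linearIndependent {ι : Type*} {w : ι → V} (hw : LinearIndependent K w)
    {i j : ι} (hij : i ≠ j) : span K {w i} ≠ span K {w j} := by
  intro h
  have h1 := hw.notMem_span_image (s := {j}) (x := i) (by simpa using hij)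
  rw [Set.image_singleton, ← h] at h1
  exact h1 (mem_span_singleton_self _)

omit [Module F V] in
lemma nontrivial_curvePoints {n : ℕ} (hn : n ≠ 0) {e : Fin (n + 1) → V}
    (he : LinearIndependent K e) : (curvePoints F e : Set (Projectivization K V)).Nontrivial := by
  refine ⟨Projectivization.mk K (e 0) (he.ne_zero 0), mem_curvePoints.2 ⟨1, 0, by simp, ?_⟩,
    Projectivization.mk K (e (Fin.last n)) (he.ne_zero _),
    mem_curvePoints.2 ⟨0, 1, by simp, ?_⟩, fun h => ?_⟩
  · rw [map_one, map_zero, param_one_zero, Projectivization.submodule_mk]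
  · rw [map_one, map_zero, param_zero_one, Projectivization.submodule_mk]
  · have h1 := congrArg Projectivization.submodule h
    rw [Projectivization.submodule_mk, Projectivization.submodule_mk] at h1
    refine span_ne_span_of_linearIndependent he (fun h2 => hn ?_) h1
    exact (congrArg Fin.val h2).symm

/-- Points all of whose coordinates are nonzero differ from the base points. -/
lemma span_ne_span_sum {ι : Type*} [Fintype ι] [Nontrivial ι] {w : ι → V}
    (hw : LinearIndependent K w) {c : ι → K} (hc : ∀ i, c i ≠ 0) (i : ι) :
    span K {w i} ≠ span K {∑ j, c j • w j} := by
  classical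
  intro h
  obtain ⟨d, -, h1⟩ := span_singleton_eq_iff.1 h.symm
  obtain ⟨j, hj⟩ := exists_ne i
  have := Fintype.linearIndependent_iff.1 hw (fun k => c k - (Pi.single i d : ι → K) k) (by
    simp only [sub_smul, Finset.sum_sub_distrib, h1]
    rw [Finset.sum_eq_single i (fun k _ hk => by rw [Pi.single_eq_of_ne hk, zero_smul]) (by simp),
      Pi.single_eq_same, sub_self]) j
  rw [Pi.single_eq_of_ne hj, sub_zero] at this
  exact hc j this

variable {τ : Gal(K/F)}

/-- The line `{(z, τⁿ(z))}`, `z ∈ ⟨a, b⟩`. -/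
def graphLine (τ : Gal(K/F)) (n : ℕ) (a b : K) : Submodule F (K × K) :=
  (span F (Set.range ![a, b])).map (LinearMap.prod LinearMap.id (τ ^ n).toLinearMap)

lemma isLineParam_graphLine {n : ℕ} {a b : K} (hab : LinearIndependent F ![a, b]) :
    IsLineParam τ n 1 a b (graphLine τ n a b) := by
  refine ⟨one_ne_zero, hab, fun p => ?_⟩
  simp only [graphLine, Submodule.mem_map, Submodule.mem_span_range_iff_exists_fun,
    Fin.sum_univ_two, inv_one, one_mul]
  constructor
  · rintro ⟨z, ⟨c, rfl⟩, rfl⟩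
    exact ⟨c 0, c 1, rfl⟩
  · rintro ⟨s, r, rfl⟩
    exact ⟨_, ⟨![s, r], rfl⟩, rfl⟩

/-- The choice `k = 1` suffices for the converse in (2). -/
lemma isLineInFamily_graphLine [Fintype F] {n h : ℕ}
    (hτn : ∀ x, (τ ^ n) x = x ^ (Fintype.card F ^ h)) {a b : K}
    (hab : LinearIndependent F ![a, b]) : IsLineInFamily h (graphLine τ n a b) := by
  refine ⟨?_, 1, map_one _, ?_⟩
  · have hinj : Function.Injective (LinearMap.prod LinearMap.id (τ ^ n).toLinearMap :
        K →ₗ[F] K × K) := fun x y hxy => congrArg Prod.fst hxy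
    rw [graphLine, ← LinearEquiv.finrank_eq (Submodule.equivMapOfInjective _ hinj _),
      finrank_span_eq_card hab, Fintype.card_fin]
  · rintro _ ⟨z, -, rfl⟩
    change (τ ^ n) z = 1 * z ^ _
    rw [one_mul, hτn]

end Points

end PseudoReg

/-! ### The main theorem. -/

theorem theorem5 {F K V : Type*} [Field F] [Fintype F] [Field K] [Algebra F K]
    [AddCommGroup V] [Module F V] [Module K V] [IsScalarTower F K V]
    (t : ℕ) (ht : t.Prime) (hq : t ≤ Fintype.card F)
    (hK : Module.finrank F K = t) (hV : Module.finrank K V = t)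
    -- the canonical subgeometry `Σ = pointsOf K W`
    (W : Submodule F V) (hW : PseudoReg.IsCanonical K W)
    -- the generator of the pointwise stabilizer of `Σ` that is induced by `x ↦ x ^ (q ^ ν)`
    (ν : ℕ) (hν₁ : 1 ≤ ν) (hν₂ : ν < t)
    (σ : K →+* K) (hσ : ∀ x, σ x = x ^ (Fintype.card F ^ ν))
    (φ : V →ₛₗ[σ] V) (hφ : ∀ w ∈ W, φ w = w)
    -- the imaginary point `⟨P⟩`, the center `Γ` and the axis `ℓ₀`
    (P : V) (hP : Submodule.span K (Set.range fun i : Fin t => (⇑φ)^[(i : ℕ)] P) = ⊤)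
    (Γ ℓ₀ : Submodule K V)
    (hΓ : Γ = Submodule.span K (Set.range fun i : Fin (t - 2) => (⇑φ)^[(i : ℕ)] P))
    (hℓ₀ : Module.finrank K ℓ₀ = 2) (hΓℓ₀ : Disjoint Γ ℓ₀)
    -- homogeneous coordinates `(a, b) ↦ ⟨a v₁ + b v₂⟩` on `ℓ₀`, based at the transversal points,
    -- in which the projection of `Σ` is `{⟨(μ, μ ^ (q ^ ν))⟩ : μ ≠ 0}`
    (v₁ v₂ : V) (hv₁ : v₁ ≠ 0) (hv₂ : v₂ ≠ 0)
    (hv₁P : v₁ ∈ (Γ ⊔ Submodule.span K {(⇑φ)^[t - 2] P}) ⊓ ℓ₀)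
    (hv₂P : v₂ ∈ (Γ ⊔ Submodule.span K {(⇑φ)^[t - 1] P}) ⊓ ℓ₀)
    (hL : PseudoReg.project Γ ℓ₀ (PseudoReg.pointsOf K W) =
      {Y | ∃ μ : K, μ ≠ 0 ∧
        Y.submodule = Submodule.span K {μ • v₁ + μ ^ (Fintype.card F ^ ν) • v₂}}) :
    (∀ h : ℕ, 1 ≤ h → h < t → ∀ f : Submodule F (K × K), PseudoReg.IsLineInFamily h f →
      PseudoReg.IsSubline F (PseudoReg.B v₁ v₂ f) ∧
      PseudoReg.project Γ ℓ₀ (PseudoReg.curveOf W Γ ℓ₀ v₁ v₂ f) = PseudoReg.B v₁ v₂ f ∧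
      ∃ n : ℕ, 1 ≤ n ∧ n < t ∧ n * ν ≡ h [MOD t] ∧
        PseudoReg.IsNRCInside W n (PseudoReg.curveOf W Γ ℓ₀ v₁ v₂ f)) ∧
    (t < Fintype.card F →
      (∀ f : Submodule F (K × K), PseudoReg.IsLineInFamily (t - ν) f →
        ∃! C : Set (Projectivization K V), PseudoReg.IsRationalNRC W (t - 1) C ∧
          C ∩ PseudoReg.pointsOf K W = PseudoReg.curveOf W Γ ℓ₀ v₁ v₂ f) ∧
      {C : Set (Projectivization K V) | PseudoReg.IsRationalNRC W (t - 1) C ∧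
        ∃ f : Submodule F (K × K), PseudoReg.IsLineInFamily (t - ν) f ∧
          C ∩ PseudoReg.pointsOf K W = PseudoReg.curveOf W Γ ℓ₀ v₁ v₂ f} =
      {C : Set (Projectivization K V) | PseudoReg.IsNRC (t - 1) C ∧
        (∀ i < t, ∃ X ∈ C, X.submodule = Submodule.span K {(⇑φ)^[i] P}) ∧
        (C ∩ PseudoReg.pointsOf K W).Nontrivial}) := by
  open PseudoReg in
  obtain ⟨m, rfl⟩ : ∃ m, t = m + 2 := ⟨t - 2, by have := ht.two_le; omega⟩
  have : FiniteDimensional F K := FiniteDimensional.of_finrank_pos (by omega)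
  have : FiniteDimensional K V := FiniteDimensional.of_finrank_pos (by omega)
  have : Finite K := Module.finite_of_finite F
  have hp : (Module.finrank F K).Prime := hK ▸ ht
  let τ := (FiniteField.frobeniusAlgEquivOfAlgebraic F K) ^ ν
  have hτx : ∀ x, τ x = x ^ (Fintype.card F ^ ν) := frobenius_pow_apply ν
  obtain rfl : σ = (τ : K →+* K) := RingHom.ext fun x => (hσ x).trans (hτx x).symm
  have hord := FiniteField.orderOf_frobeniusAlgEquivOfAlgebraic F K
  have hτ1 : τ ≠ 1 := by
    intro h
    have := orderOf_dvd_of_pow_eq_one h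
    rw [hord, hK] at this
    exact absurd (Nat.le_of_dvd hν₁ this) (by omega)
  have hτord : orderOf τ = m + 2 := (orderOf_eq_finrank_of_prime hp hτ1).trans hK
  have hτt : τ ^ (m + 2) = 1 := hτord ▸ pow_orderOf_eq_one τ
  have hτn : ∀ n, 1 ≤ n → n < m + 2 → τ ^ n ≠ 1 := by
    intro n hn1 hn2 h
    have := orderOf_le_of_pow_eq_one hn1 h
    omega
  simp only [← hτx] at hL
  obtain ⟨hv, u, p, hinj, hu, hproj, hp', hup⟩ := exists_parametrization φ hK hV hW hτt hφ hP hΓ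
    hΓℓ₀ hv₁ hv₂ hv₁P hv₂P hL
  have huW : ∀ x, u x ∈ W := fun x => hu ▸ ⟨x, rfl⟩
  have hvec : ∀ n, n < m + 2 → ∀ a b : K, LinearIndependent F ![a, b] →
      LinearIndependent K (curveVectors u τ a b n) := by
    intro n hn a b hab
    refine hW.linearIndependent (fun j => huW _) ?_
    exact (linearIndependent_orbitPoly_coeff hp hτ1 hab (hK ▸ hn)).map' u
      (LinearMap.ker_eq_bot.2 hinj)
  refine ⟨?_, fun hq' => ?_⟩
  · intro h hh1 hh2 f hf
    -- `ν` is invertible modulo the prime `t`, and `n ≠ 0` because `0 < h < t`.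
    obtain ⟨n, hn1, hn2, hnh⟩ : ∃ n, 1 ≤ n ∧ n < m + 2 ∧ n * ν ≡ h [MOD m + 2] := by
      have hcop : Nat.Coprime ν (m + 2) := (Nat.coprime_of_lt_prime (by omega) hν₂ ht).symm
      obtain ⟨n, hn, hnh⟩ := Nat.exists_mul_mod_eq_of_coprime h hcop (by omega)
      refine ⟨n, Nat.one_le_iff_ne_zero.2 ?_, hn, by rwa [mul_comm]⟩
      rintro rfl
      rw [mul_zero, Nat.zero_mod, Nat.mod_eq_of_lt hh2] at hnh
      omega
    have hτnh : ∀ x, (τ ^ n) x = x ^ (Fintype.card F ^ h) :=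
      frobenius_pow_pow_apply_of_modEq (hK.symm ▸ hnh)
    obtain ⟨κ, a, b, hfp⟩ := exists_isLineParam hp (hτn n hn1 hn2) hτnh hf
    refine ⟨isSubline_B hp hv (hτn n hn1 hn2) hfp hf.1,
      project_curveOf_eq hp hτ1 hinj hu hv hproj hfp, n, hn1, hn2, hnh,
      curveVectors u τ a b n, hvec n hn2 a b hfp.2.1, fun j => huW _,
      curveOf_eq_curvePoints hp hτ1 hinj hu hv hproj hfp⟩
  -- The family with index `-ν` corresponds to `n = t - 1`, as `(t - 1) ν ≡ -ν` modulo `t`.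
  · have hτh : ∀ x, (τ ^ (m + 1)) x = x ^ (Fintype.card F ^ (m + 2 - ν)) := by
      apply frobenius_pow_pow_apply_of_modEq
      rw [hK]
      apply Nat.ModEq.add_right_cancel' ν
      rw [Nat.sub_add_cancel hν₂.le, show (m + 1) * ν + ν = (m + 2) * ν by ring]
      exact ((Nat.modEq_zero_iff_dvd).2 (dvd_mul_right _ _)).trans
        ((Nat.modEq_zero_iff_dvd).2 dvd_rfl).symm
    have hWt : Module.finrank F W = m + 2 := hW.1.trans hV
    have hP0 : LinearIndependent K fun i : Fin (m + 2) => (⇑φ)^[(i : ℕ)] P :=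
      linearIndependent_of_top_le_span_of_card_eq_finrank hP.ge (by simp [hV])
    have hcurve : ∀ f κ a b, IsLineParam τ (m + 1) κ a b f →
        curvePoints K (curveVectors u τ a b (m + 1)) ∩ pointsOf K W =
          curveOf W Γ ℓ₀ v₁ v₂ f := by
      intro f κ a b hfp
      rw [curveOf_eq_curvePoints hp hτ1 hinj hu hv hproj hfp]
      exact curvePoints_inter_pointsOf hWt (hvec _ (by omega) a b hfp.2.1) fun j => huW _
    have huniq : ∀ f κ a b, IsLineParam τ (m + 1) κ a b f → ∀ C,
        IsRationalNRC W (m + 1) C → C ∩ pointsOf K W = curveOf W Γ ℓ₀ v₁ v₂ f →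
        C = curvePoints K (curveVectors u τ a b (m + 1)) := by
      rintro f κ a b hfp _ ⟨e, he, heW, rfl⟩ hC
      symm
      apply curvePoints_eq_of_subset hq' (hvec _ (by omega) a b hfp.2.1) he
      rw [← curveOf_eq_curvePoints hp hτ1 hinj hu hv hproj hfp, ← hC]
      exact Set.inter_subset_left
    have horbit : ∀ a b : K, LinearIndependent F ![a, b] → ∀ i < m + 2,
        ∃ X ∈ (curvePoints K (curveVectors u τ a b (m + 1)) : Set (Projectivization K V)),
          X.submodule = Submodule.span K {(⇑φ)^[i] P} := by
      intro a b hab i hi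
      have ha : ¬ (-τ b = 0 ∧ τ a = 0) := by
        rintro ⟨-, h⟩
        exact hab.ne_zero 0 ((map_eq_zero τ).1 h)
      have hi0 : (⇑φ)^[i] P ≠ 0 := hP0.ne_zero ⟨i, hi⟩
      obtain ⟨c, hc, hp0⟩ := hp' 0
      have h1 := span_eq_span_param_curveVectors hτt hc hp0 hup
        (param_ne_zero (hvec _ (by omega) a b hab) ha)
      have h2 := span_iterate_eq_span_param hφ (fun j => huW _) h1 i
      refine ⟨Projectivization.mk K _ hi0, mem_curvePoints.2
        ⟨(τ ^ i) (-τ b), (τ ^ i) (τ a), fun h => ha ?_, ?_⟩, Projectivization.submodule_mk _ _⟩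
      · exact ⟨(map_eq_zero (τ ^ i)).1 h.1, (map_eq_zero (τ ^ i)).1 h.2⟩
      · rw [Projectivization.submodule_mk]
        exact h2
    refine ⟨fun f hf => ?_, Set.ext fun C => ⟨?_, ?_⟩⟩
    · obtain ⟨κ, a, b, hfp⟩ := exists_isLineParam hp (hτn (m + 1) (by omega) (by omega)) hτh hf
      exact ⟨_, ⟨⟨_, hvec _ (by omega) a b hfp.2.1, fun j => huW _, rfl⟩, hcurve f κ a b hfp⟩,
        fun C hC => huniq f κ a b hfp C hC.1 hC.2⟩
    · rintro ⟨hC, f, hf, hCf⟩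
      obtain ⟨κ, a, b, hfp⟩ := exists_isLineParam hp (hτn (m + 1) (by omega) (by omega)) hτh hf
      obtain rfl := huniq f κ a b hfp C hC hCf
      have he := hvec (m + 1) (by omega) a b hfp.2.1
      refine ⟨⟨_, he, rfl⟩, horbit a b hfp.2.1, ?_⟩
      rw [hCf, curveOf_eq_curvePoints hp hτ1 hinj hu hv hproj hfp]
      exact nontrivial_curvePoints (by omega) he
    · rintro ⟨⟨e, he, rfl⟩, hCP, X₁, ⟨hX₁C, hX₁⟩, X₂, ⟨hX₂C, hX₂⟩, hX₁₂⟩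
      obtain ⟨μ₁, hμ₁, hX₁⟩ := (mem_pointsOf_iff_of_range_eq hinj hu).1 hX₁
      obtain ⟨μ₂, hμ₂, hX₂⟩ := (mem_pointsOf_iff_of_range_eq hinj hu).1 hX₂
      -- For `y = τ(μ⁻¹)` one has `τᵗ⁻¹(y) = μ⁻¹`, so `τᵗ⁻¹(y)/y = τ(μ)/μ`: the line spanned by
      -- these two parameters yields a curve through `X₁` and `X₂`. Distinctness of the two points
      -- gives independence over `F`.
      have hab : LinearIndependent F ![τ μ₁⁻¹, τ μ₂⁻¹] := by
        rw [LinearIndependent.pair_iff]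
        intro s r hsr
        rw [← map_smul, ← map_smul, ← map_add, map_eq_zero_iff τ τ.injective, Algebra.smul_def,
          Algebra.smul_def] at hsr
        have h1 : algebraMap F K s * μ₂ + algebraMap F K r * μ₁ = 0 := by
          field_simp at hsr
          linear_combination hsr
        by_contra hne
        apply hX₁₂
        apply Projectivization.submodule_injective
        have hr : r ≠ 0 := by
          rintro rfl
          apply hne
          simpa [hμ₂] using h1
        have hs : s ≠ 0 := by
          rintro rfl
          apply hne
          simpa [hμ₁] using h1
        have hr' : algebraMap F K r ≠ 0 := by simpa using hr
        have h2 : μ₁ = (-(s / r)) • μ₂ := by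
          rw [Algebra.smul_def, map_neg, map_div₀]
          field_simp
          linear_combination h1
        rw [hX₁, hX₂, span_singleton_eq_iff]
        refine ⟨algebraMap F K (-(s / r)), by simp [hs, hr], ?_⟩
        rw [h2, map_smul, algebraMap_smul]
      have hfp := isLineParam_graphLine (τ := τ) (n := m + 1) hab
      have hmemC : ∀ (X : Projectivization K V) (μ : K) (s r : F), μ ≠ 0 →
          X.submodule = Submodule.span K {u μ} → s • τ μ₁⁻¹ + r • τ μ₂⁻¹ = τ μ⁻¹ →
          X ∈ (curvePoints K (curveVectors u τ (τ μ₁⁻¹) (τ μ₂⁻¹) (m + 1)) :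
            Set (Projectivization K V)) := by
        intro X μ s r hμ hX hsr
        apply curvePoints_subset_curvePoints (F := F)
        rw [← curveOf_eq_curvePoints hp hτ1 hinj hu hv hproj hfp,
          mem_curveOf_iff hinj hu hv hproj]
        have hμ' : τ μ ≠ 0 := (map_ne_zero τ).2 hμ
        refine ⟨μ, hμ, hX, _, (hfp.2.2 _).2 ⟨s, r, rfl⟩, ?_, ?_⟩
        · intro h0
          have h1 := congrArg Prod.fst h0
          rw [hsr, map_inv₀] at h1
          simp [hμ] at h1
        · have h1 : (τ ^ (m + 1)) (τ μ⁻¹) = μ⁻¹ := by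
            rw [← AlgEquiv.mul_apply, ← pow_succ, hτt]
            rfl
          dsimp only
          rw [hsr, h1, map_inv₀, inv_one, one_mul, one_mul, mul_inv_cancel₀ hμ, mul_inv_cancel₀ hμ']
      -- The `t` imaginary points and the two points of the subgeometry: `t + 2` common points for
      -- curves of order `t - 1`.
      let Y : Option (Option (Fin (m + 1 + 1))) → Projectivization K V := fun o =>
        o.elim X₁ fun o => o.elim X₂ fun i => Projectivization.mk K _ (hP0.ne_zero i)
      -- Points of the subgeometry have all coordinates nonzero in the basis `φⁱ(P)`, so they differ
      -- from the imaginary points.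
      have hne : ∀ (i : Fin (m + 2)) (μ : K) (X : Projectivization K V), μ ≠ 0 →
          X.submodule = Submodule.span K {u μ} →
          Projectivization.mk K _ (hP0.ne_zero i) ≠ X := by
        intro i μ X hμ hX h
        choose c hc hpc using hp'
        refine span_ne_span_sum hP0 (c := fun j => (τ ^ ((j : ℕ) + 2)) μ * c j) (fun j =>
          mul_ne_zero ((map_ne_zero _).2 hμ) (hc j)) i ?_
        rw [← Projectivization.submodule_mk (K := K) _ (hP0.ne_zero i), h, hX, hup]
        simp only [mul_smul, hpc]
      have hY : Function.Injective Y := by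
        rintro (_ | _ | i) (_ | _ | j) hij
        · rfl
        · exact absurd hij hX₁₂
        · exact absurd hij.symm (hne j μ₁ X₁ hμ₁ hX₁)
        · exact absurd hij.symm hX₁₂
        · rfl
        · exact absurd hij.symm (hne j μ₂ X₂ hμ₂ hX₂)
        · exact absurd hij (hne i μ₁ X₁ hμ₁ hX₁)
        · exact absurd hij (hne i μ₂ X₂ hμ₂ hX₂)
        · by_contra h
          have h1 := congrArg Projectivization.submodule hij
          exact span_ne_span_of_linearIndependent hP0 (i := i) (j := j) (fun h2 => h (by rw [h2]))
            (by simpa [Y] using h1)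
      have hYe : ∀ o, Y o ∈ (curvePoints K e : Set (Projectivization K V)) := by
        rintro (_ | _ | i)
        · exact hX₁C
        · exact hX₂C
        · obtain ⟨X, hX, h⟩ := hCP i i.isLt
          rwa [show Y (some (some i)) = X from
            Projectivization.submodule_injective ((Projectivization.submodule_mk _ _).trans h.symm)]
      have hYc : ∀ o, Y o ∈ (curvePoints K (curveVectors u τ (τ μ₁⁻¹) (τ μ₂⁻¹) (m + 1)) :
          Set (Projectivization K V)) := by
        rintro (_ | _ | i)
        · exact hmemC X₁ μ₁ 1 0 hμ₁ hX₁ (by simp)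
        · exact hmemC X₂ μ₂ 0 1 hμ₂ hX₂ (by simp)
        · obtain ⟨X, hX, h⟩ := horbit _ _ hab i i.isLt
          rwa [show Y (some (some i)) = X from
            Projectivization.submodule_injective ((Projectivization.submodule_mk _ _).trans h.symm)]
      have hvC := hvec (m + 1) (by omega) _ _ hab
      have heq : (curvePoints K e : Set (Projectivization K V)) =
          curvePoints K (curveVectors u τ (τ μ₁⁻¹) (τ μ₂⁻¹) (m + 1)) :=
        Set.Subset.antisymm (curvePoints_subset_of_common_points he hY hYe hYc)
          (curvePoints_subset_of_common_points hvC hY hYc hYe)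
      rw [heq]
      exact ⟨⟨_, hvC, fun j => huW _, rfl⟩, _, isLineInFamily_graphLine hτh hab,
        hcurve _ _ _ _ hfp⟩
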